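/- Let $\Sigma$ be a finite alphabet, $\mathfrak D$ an infinite set of data values, and let $\triangleleft,\triangleright$ be two distinct end markers outside $\Sigma\cup\mathfrak D$. A data word is a finite sequence $w=\binom{\sigma_1}{a_1}\cdots\binom{\sigma_n}{a_n}$ over $\Sigma\times\mathfrak D$. It is given to an automaton as $\triangleleft w\triangleright$, with positions $0,\dots,n+1$; we put $\sigma_0=a_0=\triangleleft$ and $\sigma_{n+1}=a_{n+1}=\triangleright$. A (one-way, alternating) top view weak $k$-PA ($k\ge 1$) is $\mathcal A=\langle\Sigma,Q,q_0,F,\mu,U\rangle$ with a finite set $Q$ of states, $q_0\in Q$, final states $F\subseteq Q$, universal states $U\subseteq Q\setminus F$, and a set $\mu$ of transitions $(i,\sigma,V,q)\to(q',\mathtt{act})$, where $1\le i\le k$, $\sigma\in\Sigma\cup\{\triangleleft,\triangleright\}$, $V\in\{\emptyset,\{i+1\}\}$ (only $V=\emptyset$ if $i=k$) and $\mathtt{act}\in\{\mathtt{stay},\mathtt{right},\mathtt{lift\text{-}pebble},\mathtt{place\text{-}pebble}\}$; it is nondeterministic if $U=\emptyset$. A configuration on $w$ is $[i,q,\theta]$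 with $q\in Q$ and $\theta:\{i,\dots,k\}\to\{0,\dots,n+1\}$. The transition applies to $[i,q,\theta]$ if $\sigma=\sigma_{\theta(i)}$ and $V=\{i+1\}$ or $V=\emptyset$ according to whether or not ($i<k$ and $a_{\theta(i+1)}=a_{\theta(i)}$). It then leads to state $q'$ and, respectively, changes nothing else, moves pebble $i$ one position to the right, lifts pebble $i$ (so that pebble $i+1$ is the head), or places pebble $i-1$ at position $\theta(i)$ (so that pebble $i-1$ is the head); a step that would not yield a configuration is impossible. "Leads to acceptance" is the least property of configurations that holds if $q\in F$, or if $q\in U$ and all successors have it, or if $q\notin F\cup U$ and some successor has it. $L(\mathcal A)$ is the set of all $w$ for which $[k,q_0,k\mapsto 0]$ leads to acceptance. A one-way alternating one-register automaton (1-RA) has a finite set of states, an initial state, final states, an initial content of its register (a data value, or empty), and finitely many transitions of the following forms: on $\triangleleft$, or on $\triangleright$, change the state; on a position with label $\sigma\in\Sigma$ change the state, depending on whether or not the register contains the current data value; change the state and optionally store the current data value in the register (storing is possible only on positions $1,\dots,n$); branch conjunctively, $q\to q_1\wedge\dots\wedge q_m$, or disjunctively, $q\to q_1\vee\dots\vee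 q_m$, with $m\ge1$; change the state and move one position to the right (impossible on $\triangleright$). "Leads to acceptance" is the least property of configurations (position, state, register) that holds if the state is final, or if some applicable transition has a successor with the property, where for a conjunctive branching all successors must have it. The language consists of all $w$ for which the initial configuration, at position $0$, leads to acceptance. **Theorem.** For every $k\ge1$ and every top view weak $k$-PA $\mathcal A$ there is a one-way alternating 1-RA $\mathcal A'$ with $L(\mathcal A')=L(\mathcal A)$. Moreover, the construction is effective: there is a computable function that maps each triple consisting of the size of $\Sigma$, the number $k$, and a finite description of a top view weak $k$-PA $\mathcal A$ over $\Sigma$ to a finite description of a one-way alternating 1-RA $\mathcal A'$ over $\Sigma$, with initially empty register, such that $L(\mathcal A')=L(\mathcal A)$ for every infinite set $\mathfrak D$ of data values. -/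

import Mathlib

/-! ## Data words with end markers -/

/-- An element of `α`, or one of the two end markers. -/
inductive Marked (α : Type*) where
  | leftEnd : Marked α
  | letter (a : α) : Marked α
  | rightEnd : Marked α

/-- Apply a function to the unmarked elements; the end markers are kept. -/
def Marked.map {α β : Type*} (f : α → β) : Marked α → Marked β
  | .leftEnd => .leftEnd
  | .letter a => .letter (f a)
  | .rightEnd => .rightEnd

/-- The content of position `j` of the input `w` between its two end markers: position `0` holds the
left-end marker, positions `1, …, n` hold the `n` letters of `w`, and position `n + 1` holds the
right-end marker. -/
def tape {A D : Type*} (w : List (A × D)) : ℕ → Marked (A × D)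
  | 0 => .leftEnd
  | j + 1 =>
    match w[j]? with
    | some x => .letter x
    | none => .rightEnd

/-- The label (a letter of the alphabet, or an end marker) at position `j`. -/
def labelAt {A D : Type*} (w : List (A × D)) (j : ℕ) : Marked A := (tape w j).map Prod.fst

/-- The data value at position `j`. The two end markers are not data values, and they are different
from each other; at its position each of them stands in place of a data value. -/
def valueAt {A D : Type*} (w : List (A × D)) (j : ℕ) : Marked D := (tape w j).map Prod.snd

/-! ## Top view weak pebble automata -/

/-- The actions of a pebble automaton. -/
inductive PebbleAction where
  | stay
  | right
  | liftPebble
  | placePebble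

/-- A transition `(i, σ, V, q) → (q', act)` of a top view weak pebble automaton. As `V` is either `∅`
or `{i + 1}`, it is given by a Boolean: `same = true` stands for `V = {i + 1}` and `same = false`
for `V = ∅`. -/
structure PebbleTransition (A Q : Type*) where
  pebble : ℕ
  label : Marked A
  same : Bool
  source : Q
  target : Q
  action : PebbleAction

/-- A (one-way, alternating) top view weak `k`-pebble automaton over the alphabet `A` with the set
`Q` of states. The nondeterministic ones are those with `univ = ∅`. -/
structure TopViewWeakPA (A Q : Type*) (k : ℕ) where
  init : Q
  final : Set Q
  univ : Set Q
  univ_disjoint_final : Disjoint univ final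
  trans : Set (PebbleTransition A Q)
  pebble_mem : ∀ t ∈ trans, 1 ≤ t.pebble ∧ t.pebble ≤ k
  same_lt : ∀ t ∈ trans, t.same = true → t.pebble < k

/-- A configuration `[i, q, θ]`, where `i = pebble` is the number of the head pebble, `q = state`, and
the pebble assignment `θ` on `{i, …, k}` is given by `θ(i) = head` and
`[θ(i + 1), …, θ(k)] = others`. -/
structure PebbleConfig (Q : Type*) where
  pebble : ℕ
  state : Q
  head : ℕ
  others : List ℕ

namespace TopViewWeakPA

variable {A Q D : Type*} {k : ℕ}

/-- The transition `t` applies to the configuration `c` on the input `w`. Pebble `i` is compared with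
pebble `i + 1` only, which is the first of the other pebbles, if there is one. -/
def Applies (w : List (A × D)) (t : PebbleTransition A Q) (c : PebbleConfig Q) : Prop :=
  t.pebble = c.pebble ∧ t.source = c.state ∧ t.label = labelAt w c.head ∧
    (t.same = true ↔ ∃ p ∈ c.others.head?, valueAt w p = valueAt w c.head)

/-- The one-step relation between configurations on the input `w`. A step that would leave the set of
configurations is impossible: the head pebble cannot move right from the right-end marker, pebble
`k` cannot be lifted, and no pebble can be placed when pebble `1` is the head pebble. -/
inductive Step (M : TopViewWeakPA A Q k) (w : List (A × D)) : PebbleConfig Q → PebbleConfig Q → Prop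
  | stay (t : PebbleTransition A Q) (ht : t ∈ M.trans) (i : ℕ) (q : Q) (h : ℕ) (r : List ℕ)
      (happ : Applies w t ⟨i, q, h, r⟩) (hact : t.action = .stay) :
      Step M w ⟨i, q, h, r⟩ ⟨i, t.target, h, r⟩
  | right (t : PebbleTransition A Q) (ht : t ∈ M.trans) (i : ℕ) (q : Q) (h : ℕ) (r : List ℕ)
      (happ : Applies w t ⟨i, q, h, r⟩) (hact : t.action = .right) (hh : h ≤ w.length) :
      Step M w ⟨i, q, h, r⟩ ⟨i, t.target, h + 1, r⟩
  | lift (t : PebbleTransition A Q) (ht : t ∈ M.trans) (i : ℕ) (q : Q) (h p : ℕ) (r : List ℕ)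
      (happ : Applies w t ⟨i, q, h, p :: r⟩) (hact : t.action = .liftPebble) :
      Step M w ⟨i, q, h, p :: r⟩ ⟨i + 1, t.target, p, r⟩
  | place (t : PebbleTransition A Q) (ht : t ∈ M.trans) (i : ℕ) (q : Q) (h : ℕ) (r : List ℕ)
      (happ : Applies w t ⟨i + 1, q, h, r⟩) (hact : t.action = .placePebble) (hi : 1 ≤ i) :
      Step M w ⟨i + 1, q, h, r⟩ ⟨i, t.target, h, h :: r⟩

/-- The configuration leads to acceptance (the least relation that satisfies the three clauses). -/
inductive LeadsToAcceptance (M : TopViewWeakPA A Q k) (w : List (A × D)) : PebbleConfig Q → Prop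
  | final (c : PebbleConfig Q) (hc : c.state ∈ M.final) : LeadsToAcceptance M w c
  | universal (c : PebbleConfig Q) (hc : c.state ∈ M.univ)
      (h : ∀ c', Step M w c c' → LeadsToAcceptance M w c') : LeadsToAcceptance M w c
  | existential (c c' : PebbleConfig Q) (hf : c.state ∉ M.final) (hu : c.state ∉ M.univ)
      (hs : Step M w c c') (h : LeadsToAcceptance M w c') : LeadsToAcceptance M w c

/-- The data language accepted by the automaton: at the start only pebble `k` is present, on the
left-end marker. -/
def language (D : Type*) (M : TopViewWeakPA A Q k) : Set (List (A × D)) :=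
  {w | LeadsToAcceptance M w ⟨k, M.init, 0, []⟩}

end TopViewWeakPA

/-! ## One-way alternating one-register automata -/

/-- The transitions of a one-way alternating automaton with one register:

* `atLeft q q'` and `atRight q q'` change the state on the left-end and the right-end marker;
* `read q σ b q'` changes the state on a position with label `σ`, where `b` tells whether the register
  contains the current data value;
* `store q b q'` changes the state and, if `b = true`, stores the current data value in the register;
* `conj q q₁ [q₂, …, qₘ]` and `disj q q₁ [q₂, …, qₘ]` branch conjunctively and disjunctively into
  `q₁, …, qₘ`, where `m ≥ 1`;
* `right q q'` changes the state and moves to the next position. -/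
inductive RegisterTransition (A Q : Type*) where
  | atLeft (q q' : Q)
  | atRight (q q' : Q)
  | read (q : Q) (σ : A) (b : Bool) (q' : Q)
  | store (q : Q) (b : Bool) (q' : Q)
  | conj (q q₁ : Q) (qs : List Q)
  | disj (q q₁ : Q) (qs : List Q)
  | right (q q' : Q)

/-- A one-way alternating one-register automaton over the alphabet `A` and the data values `D`, with
the set `Q` of states. The content `none` of the register means that no data value has been stored
in it. -/
structure OneRegisterAutomaton (A D Q : Type*) where
  init : Q
  initRegister : Option D
  final : Set Q
  trans : Set (RegisterTransition A Q)
  trans_finite : trans.Finite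

/-- A configuration of a one-register automaton: position of the head, state, and register. -/
structure RegisterConfig (D Q : Type*) where
  head : ℕ
  state : Q
  register : Option D

namespace OneRegisterAutomaton

variable {A D Q : Type*}

/-- A single step by a transition that is not branching. A data value can be stored only on a position
that carries one, and the head cannot move right from the right-end marker. -/
inductive Step (M : OneRegisterAutomaton A D Q) (w : List (A × D)) :
    RegisterConfig D Q → RegisterConfig D Q → Prop
  | atLeft (j : ℕ) (q q' : Q) (u : Option D) (ht : RegisterTransition.atLeft q q' ∈ M.trans)
      (hj : tape w j = .leftEnd) : Step M w ⟨j, q, u⟩ ⟨j, q', u⟩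
  | atRight (j : ℕ) (q q' : Q) (u : Option D) (ht : RegisterTransition.atRight q q' ∈ M.trans)
      (hj : tape w j = .rightEnd) : Step M w ⟨j, q, u⟩ ⟨j, q', u⟩
  | read (j : ℕ) (q q' : Q) (u : Option D) (σ : A) (d : D) (b : Bool)
      (ht : RegisterTransition.read q σ b q' ∈ M.trans)
      (hj : tape w j = .letter (σ, d)) (hb : b = true ↔ u = some d) :
      Step M w ⟨j, q, u⟩ ⟨j, q', u⟩
  | skip (j : ℕ) (q q' : Q) (u : Option D) (ht : RegisterTransition.store q false q' ∈ M.trans) :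
      Step M w ⟨j, q, u⟩ ⟨j, q', u⟩
  | store (j : ℕ) (q q' : Q) (u : Option D) (σ : A) (d : D)
      (ht : RegisterTransition.store q true q' ∈ M.trans) (hj : tape w j = .letter (σ, d)) :
      Step M w ⟨j, q, u⟩ ⟨j, q', some d⟩
  | right (j : ℕ) (q q' : Q) (u : Option D) (ht : RegisterTransition.right q q' ∈ M.trans)
      (hj : j ≤ w.length) : Step M w ⟨j, q, u⟩ ⟨j + 1, q', u⟩

/-- The configuration leads to acceptance: its state is final, or some transition that can be applied
to it has a successor that leads to acceptance, where a conjunctive branching requires this of all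
its successors (the least relation with these clauses). -/
inductive LeadsToAcceptance (M : OneRegisterAutomaton A D Q) (w : List (A × D)) :
    RegisterConfig D Q → Prop
  | final (c : RegisterConfig D Q) (hc : c.state ∈ M.final) : LeadsToAcceptance M w c
  | step (c c' : RegisterConfig D Q) (hs : Step M w c c') (h : LeadsToAcceptance M w c') :
      LeadsToAcceptance M w c
  | disj (j : ℕ) (q q₁ : Q) (qs : List Q) (u : Option D)
      (ht : RegisterTransition.disj q q₁ qs ∈ M.trans) (p : Q) (hp : p ∈ q₁ :: qs)
      (h : LeadsToAcceptance M w ⟨j, p, u⟩) : LeadsToAcceptance M w ⟨j, q, u⟩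
  | conj (j : ℕ) (q q₁ : Q) (qs : List Q) (u : Option D)
      (ht : RegisterTransition.conj q q₁ qs ∈ M.trans)
      (h : ∀ p ∈ q₁ :: qs, LeadsToAcceptance M w ⟨j, p, u⟩) : LeadsToAcceptance M w ⟨j, q, u⟩

/-- The data language accepted by the automaton. -/
def language (M : OneRegisterAutomaton A D Q) : Set (List (A × D)) :=
  {w | LeadsToAcceptance M w ⟨0, M.init, M.initRegister⟩}

end OneRegisterAutomaton

/-! ## Finite descriptions of automata

An automaton over the alphabet `Fin s` with states `Fin (m + 1)` is described by natural numbers and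
lists of them. Every description describes an automaton, as entries that are out of range are
ignored. -/

/-- The number of a label: `0` and `1` for the end markers, `a + 2` for the letter `a`. -/
def Marked.code {s : ℕ} : Marked (Fin s) → ℕ
  | .leftEnd => 0
  | .rightEnd => 1
  | .letter a => a.val + 2

/-- The number of an action. -/
def PebbleAction.code : PebbleAction → ℕ
  | .stay => 0
  | .right => 1
  | .liftPebble => 2
  | .placePebble => 3

/-- Descriptions of transitions of a pebble automaton: pebble, label, Boolean, old state, new state,
action. -/
abbrev PebbleTransitionCode : Type := ℕ × ℕ × Bool × ℕ × ℕ × ℕ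

/-- The description of a transition of a pebble automaton. -/
def PebbleTransition.code {s m : ℕ} (t : PebbleTransition (Fin s) (Fin m)) : PebbleTransitionCode :=
  (t.pebble, t.label.code, t.same, t.source.val, t.target.val, t.action.code)

/-- Descriptions of top view weak pebble automata: the number of states minus one, the initial state,
the final states, the universal states, and the transitions. -/
abbrev TopViewWeakPACode : Type := ℕ × ℕ × List ℕ × List ℕ × List PebbleTransitionCode

/-- The top view weak `k`-pebble automaton over the alphabet `Fin s` with a given description. -/
def TopViewWeakPA.ofCode (s k : ℕ) (c : TopViewWeakPACode) :
    TopViewWeakPA (Fin s) (Fin (c.1 + 1)) k where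
  init := Fin.ofNat (c.1 + 1) c.2.1
  final := {q | q.val ∈ c.2.2.1}
  univ := {q | q.val ∈ c.2.2.2.1 ∧ q.val ∉ c.2.2.1}
  univ_disjoint_final := Set.disjoint_left.2 fun _ h h' => h.2 h'
  trans := {t | t.code ∈ c.2.2.2.2 ∧ (1 ≤ t.pebble ∧ t.pebble ≤ k) ∧
    (t.same = true → t.pebble < k)}
  pebble_mem := fun _ h => h.2.1
  same_lt := fun _ h => h.2.2

/-- Descriptions of transitions of a one-register automaton: kind of the transition, old state, letter,
Boolean, and the list of new states. -/
abbrev RegisterTransitionCode : Type := ℕ × ℕ × ℕ × Bool × List ℕ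

/-- The description of a transition of a one-register automaton. -/
def RegisterTransition.code {s m : ℕ} :
    RegisterTransition (Fin s) (Fin m) → RegisterTransitionCode
  | .atLeft q q' => (0, q.val, 0, false, [q'.val])
  | .atRight q q' => (1, q.val, 0, false, [q'.val])
  | .read q σ b q' => (2, q.val, σ.val, b, [q'.val])
  | .store q b q' => (3, q.val, 0, b, [q'.val])
  | .conj q q₁ qs => (4, q.val, 0, false, (q₁ :: qs).map Fin.val)
  | .disj q q₁ qs => (5, q.val, 0, false, (q₁ :: qs).map Fin.val)
  | .right q q' => (6, q.val, 0, false, [q'.val])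

theorem RegisterTransition.code_injective {s m : ℕ} :
    Function.Injective (RegisterTransition.code (s := s) (m := m)) := by
  have hm : Function.Injective (List.map (Fin.val : Fin m → ℕ)) :=
    List.map_injective_iff.2 Fin.val_injective
  intro t t' h
  cases t <;> cases t' <;>
    simp_all [RegisterTransition.code, Fin.ext_iff, hm.eq_iff]

/-- Descriptions of one-register automata: the number of states minus one, the initial state, the final
states, and the transitions. -/
abbrev OneRegisterAutomatonCode : Type := ℕ × ℕ × List ℕ × List RegisterTransitionCode

/-- The one-way alternating one-register automaton over the alphabet `Fin s` with a given description.
Its register is empty at the start. -/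
def OneRegisterAutomaton.ofCode (s : ℕ) (D : Type*) (c : OneRegisterAutomatonCode) :
    OneRegisterAutomaton (Fin s) D (Fin (c.1 + 1)) where
  init := Fin.ofNat (c.1 + 1) c.2.1
  initRegister := none
  final := {q | q.val ∈ c.2.2.1}
  trans := {t | t.code ∈ c.2.2.2}
  trans_finite :=
    Set.Finite.preimage RegisterTransition.code_injective.injOn (List.finite_toSet c.2.2.2)

/-! ## The simulating one-register automaton, on descriptions -/

/-! While pebble `i` is the head, the pebbles above it stay where they are, and the top view
restriction only asks whether the value under it equals the value under pebble `i + 1`. So one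
register holds all the data that matters, with a finite mode for the case that pebble `i + 1` stands
on an end marker.

The difficulty is lifting: pebble `i` resumes where it was left, a position to which a one-way head
cannot return, and the register has been overwritten since. Hence, when pebble `i - 1` is placed,
the simulation guesses the set `R'` of states to which lifting it may lead, and branches
conjunctively. One branch runs pebble `i - 1` with the current value stored; for each state in `R'`,
another branch resumes pebble `i` at once, with the position and the register it has at that moment.
A lift then only tests whether the new state is in the return set. Pebble numbers, states and return
sets are bounded, so finitely many states suffice.

Both notions of acceptance are least fixed points, and each inclusion is an induction. For soundness
(`sound_of_rules`), a state of the simulation is read as an implication: for all pebble positions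
that fit the mode and the register, if the pebble automaton accepts after every lift allowed by the
return set, it accepts from the present configuration. For completeness (`complete_of_leadsTo`), the
guess is the canonical `returnSet`, defined by acceptance of the simulation itself: the resuming
branches then accept by definition, and at a lift the induction hypothesis says that the new state
belongs to the set. Single steps are matched by `mem_choices_iff` and the lemmas on `Executes`.

The construction acts on numbers and lists and is primitive recursive (`primrec_simCode`). Arbitrary
finite alphabets and state sets reduce to descriptions by renaming (`exists_ofCode`). -/

namespace PebbleSim

/-- The parameters of the simulation: the size of the alphabet, the number of pebbles and the
description of the pebble automaton. -/
abbrev Params : Type := ℕ × ℕ × TopViewWeakPACode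

/-- States of the simulation: kind, head pebble, state of the pebble automaton, register mode, return
set, label, and an auxiliary number. -/
abbrev SimState : Type := ℕ × ℕ × ℕ × ℕ × ℕ × ℕ × ℕ

/-- A transition of the simulation: its kind as in `RegisterTransitionCode`, a letter, a Boolean, and
the list of targets. -/
abbrev Rule : Type := ℕ × ℕ × Bool × List SimState

/-- Simulate head pebble `i` in state `q`. The mode `v` is `0` or `1` if pebble `i + 1` is on the left
or the right end, and `2` if its data value is the content of the register (empty if there is no
such pebble). The bits of `R` are the states in which pebble `i` may be lifted. -/
def main (i q v R : ℕ) : SimState := (0, i, q, v, R, 0, 0)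

/-- Choose a transition; the label at the head has code `σ`, and `x` is `1` if the values under pebbles
`i` and `i + 1` agree and `0` if not. -/
def sel (i q v R σ x : ℕ) : SimState := (1, i, q, v, R, σ, x)

/-- Move right, then go on with `main`. -/
def move (i q v R : ℕ) : SimState := (2, i, q, v, R, 0, 0)

/-- Guess the return set of the pebble that is placed. -/
def guess (i q v R σ : ℕ) : SimState := (3, i, q, v, R, σ, 0)

/-- Place pebble `i - 1` with return set `R'`. -/
def place (i q v R σ R' : ℕ) : SimState := (4, i, q, v, R, σ, R')

/-- Store the current data value if the mode is `2`, then go on with `main`. -/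
def store (i q v R : ℕ) : SimState := (5, i, q, v, R, 0, 0)

/-- The accepting sink. -/
def accept : SimState := (6, 0, 0, 0, 0, 0, 0)

/-- The rejecting sink. -/
def reject : SimState := (7, 0, 0, 0, 0, 0, 0)

/-- In modes `0` and `1` the register may hold a stale value, so finding the current value in it
counts as agreement only in mode `2`. On an end marker the mode alone decides. -/
def mainRules (P : Params) (y : SimState) : List Rule :=
  (0, 0, false, [sel y.2.1 y.2.2.1 y.2.2.2.1 y.2.2.2.2.1 0 (y.2.2.2.1 == 0).toNat]) ::
  (1, 0, false, [sel y.2.1 y.2.2.1 y.2.2.2.1 y.2.2.2.2.1 1 (y.2.2.2.1 == 1).toNat]) ::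
  (List.range P.1).flatMap fun a =>
    [(2, a, true, [sel y.2.1 y.2.2.1 y.2.2.2.1 y.2.2.2.2.1 (a + 2) (decide (2 ≤ y.2.2.2.1)).toNat]),
      (2, a, false, [sel y.2.1 y.2.2.1 y.2.2.2.1 y.2.2.2.2.1 (a + 2) 0])]

/-- Whether the transition `t` of the pebble automaton can be chosen in the state `y`. -/
def applicable (P : Params) (y : SimState) (t : PebbleTransitionCode) : Bool :=
  t.1 == y.2.1 && decide (1 ≤ t.1) && decide (t.1 ≤ P.2.1) && (!t.2.2.1 || decide (t.1 + 1 ≤ P.2.1)) &&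
    t.2.1 == y.2.2.2.2.2.1 && t.2.2.1.toNat == y.2.2.2.2.2.2 && t.2.2.2.1 == y.2.2.1 &&
    decide (t.2.2.2.2.1 ≤ P.2.2.1)

/-- The states that execute the transition `t`; there are none if its action is impossible. -/
def targets (P : Params) (y : SimState) (t : PebbleTransitionCode) : List SimState :=
  bif t.2.2.2.2.2 == 0 then [main y.2.1 t.2.2.2.2.1 y.2.2.2.1 y.2.2.2.2.1]
  else bif t.2.2.2.2.2 == 1 then
    bif y.2.2.2.2.2.1 == 1 then [] else [move y.2.1 t.2.2.2.2.1 y.2.2.2.1 y.2.2.2.2.1]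
  else bif t.2.2.2.2.2 == 2 then
    bif decide (y.2.1 + 1 ≤ P.2.1) then
      [bif y.2.2.2.2.1.testBit t.2.2.2.2.1 then accept else reject] else []
  else bif t.2.2.2.2.2 == 3 then
    bif decide (2 ≤ y.2.1) then
      [guess y.2.1 t.2.2.2.2.1 y.2.2.2.1 y.2.2.2.2.1 y.2.2.2.2.2.1] else []
  else []

def choices (P : Params) (y : SimState) : List SimState :=
  P.2.2.2.2.2.2.flatMap fun t => bif applicable P y t then targets P y t else []

/-- The sinks are neutral for the respective branching and keep the list nonempty: without an
applicable transition a universal state accepts and an existential one does not. -/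
def selRules (P : Params) (y : SimState) : List Rule :=
  [bif P.2.2.2.2.2.1.contains y.2.2.1 && !P.2.2.2.2.1.contains y.2.2.1 then
    (4, 0, false, accept :: choices P y) else (5, 0, false, reject :: choices P y)]

def moveRules (y : SimState) : List Rule :=
  [(6, 0, false, [main y.2.1 y.2.2.1 y.2.2.2.1 y.2.2.2.2.1])]

def guessRules (P : Params) (y : SimState) : List Rule :=
  [(5, 0, false, reject :: (List.range (2 ^ (P.2.2.1 + 1))).map fun R' =>
    place y.2.1 y.2.2.1 y.2.2.2.1 y.2.2.2.2.1 y.2.2.2.2.2.1 R')]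

/-- The continuations after a lift start here, before the head moves on and the register is
overwritten. The label code, cut off at `2`, is the mode of the new head pebble. -/
def placeRules (P : Params) (y : SimState) : List Rule :=
  [(4, 0, false, store (y.2.1 - 1) y.2.2.1 (min y.2.2.2.2.2.1 2) y.2.2.2.2.2.2 ::
    (List.range (P.2.2.1 + 1)).flatMap fun q =>
      bif y.2.2.2.2.2.2.testBit q then [main y.2.1 q y.2.2.2.1 y.2.2.2.2.1] else [])]

/-- An end marker cannot be stored; in that case the mode carries the information and the old
content stays. -/
def storeRules (y : SimState) : List Rule :=
  [(3, 0, decide (2 ≤ y.2.2.2.1), [main y.2.1 y.2.2.1 y.2.2.2.1 y.2.2.2.2.1])]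

/-- The transitions of the simulation from a given state. -/
def rules (P : Params) (y : SimState) : List Rule :=
  bif y.1 == 0 then mainRules P y
  else bif y.1 == 1 then selRules P y
  else bif y.1 == 2 then moveRules y
  else bif y.1 == 3 then guessRules P y
  else bif y.1 == 4 then placeRules P y
  else bif y.1 == 5 then storeRules y
  else []

/-- The final states of the simulation. -/
def isFinal (P : Params) (y : SimState) : Bool :=
  y.1 == 6 || (y.1 == 0 && P.2.2.2.2.1.contains y.2.2.1)

/-- The code of a state. -/
def stateCode (y : SimState) : ℕ :=
  Nat.pair y.1 (Nat.pair y.2.1 (Nat.pair y.2.2.1 (Nat.pair y.2.2.2.1 (Nat.pair y.2.2.2.2.1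
    (Nat.pair y.2.2.2.2.2.1 y.2.2.2.2.2.2)))))

/-- The state with a given code. -/
def stateOf (n : ℕ) : SimState :=
  (n.unpair.1, n.unpair.2.unpair.1, n.unpair.2.unpair.2.unpair.1,
    n.unpair.2.unpair.2.unpair.2.unpair.1, n.unpair.2.unpair.2.unpair.2.unpair.2.unpair.1,
    n.unpair.2.unpair.2.unpair.2.unpair.2.unpair.2.unpair.1,
    n.unpair.2.unpair.2.unpair.2.unpair.2.unpair.2.unpair.2)

theorem stateOf_stateCode (y : SimState) : stateOf (stateCode y) = y := by
  simp [stateOf, stateCode]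

/-- A bound for the codes of the states. -/
def bound (P : Params) : ℕ :=
  stateCode (7, P.2.1, P.2.2.1, 2, 2 ^ (P.2.2.1 + 1), P.1 + 1, 2 ^ (P.2.2.1 + 1))

/-- The description of a rule from the state with code `x`. -/
def ruleCode (x : ℕ) (t : Rule) : RegisterTransitionCode :=
  (t.1, x, t.2.1, t.2.2.1, t.2.2.2.map stateCode)

/-- The description of the simulating one-register automaton. -/
def simCode (P : Params) : OneRegisterAutomatonCode :=
  (bound P, stateCode (main P.2.1 (P.2.2.2.1 % (P.2.2.1 + 1)) 2 0),
    (List.range (bound P + 1)).flatMap (fun x => bif isFinal P (stateOf x) then [x] else []),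
    (List.range (bound P + 1)).flatMap fun x => (rules P (stateOf x)).map (ruleCode x))

/-! ### Primitive recursiveness of the construction -/

section Primrec

attribute [local fun_prop] Primrec

variable {α β γ σ : Type*} [Primcodable α] [Primcodable β] [Primcodable γ] [Primcodable σ]

-- These closure properties let `fun_prop` take apart the definitions above, which for this purpose
-- use projections, `bif` and Boolean tests instead of pattern matching.
@[fun_prop] theorem primrec_id : Primrec (fun a : α => a) := Primrec.id

@[fun_prop] theorem primrec_const (x : σ) : Primrec (fun _ : α => x) := Primrec.const x

@[fun_prop] theorem primrec_comp {f : β → σ} {g : α → β} (hf : Primrec f) (hg : Primrec g) :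
    Primrec (fun a => f (g a)) := hf.comp hg

@[fun_prop] theorem primrec_fst {f : α → β × γ} (hf : Primrec f) : Primrec (fun a => (f a).1) :=
  Primrec.fst.comp hf

@[fun_prop] theorem primrec_snd {f : α → β × γ} (hf : Primrec f) : Primrec (fun a => (f a).2) :=
  Primrec.snd.comp hf

@[fun_prop] theorem primrec_pair {f : α → β} {g : α → γ} (hf : Primrec f) (hg : Primrec g) :
    Primrec (fun a => (f a, g a)) := Primrec.pair hf hg

@[fun_prop] theorem primrec_add {f g : α → ℕ} (hf : Primrec f) (hg : Primrec g) :
    Primrec (fun a => f a + g a) := Primrec.nat_add.comp hf hg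

@[fun_prop] theorem primrec_sub {f g : α → ℕ} (hf : Primrec f) (hg : Primrec g) :
    Primrec (fun a => f a - g a) := Primrec.nat_sub.comp hf hg

@[fun_prop] theorem primrec_mod {f g : α → ℕ} (hf : Primrec f) (hg : Primrec g) :
    Primrec (fun a => f a % g a) := Primrec.nat_mod.comp hf hg

@[fun_prop] theorem primrec_min {f g : α → ℕ} (hf : Primrec f) (hg : Primrec g) :
    Primrec (fun a => min (f a) (g a)) := Primrec.nat_min.comp hf hg

@[fun_prop] theorem primrec_pow {f g : α → ℕ} (hf : Primrec f) (hg : Primrec g) :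
    Primrec (fun a => f a ^ g a) := 
    Primrec₂.comp (f := fun m n : ℕ => m ^ n) (Primrec₂.unpaired'.1 Nat.Primrec.pow) hf hg

@[fun_prop] theorem primrec_testBit {f g : α → ℕ} (hf : Primrec f) (hg : Primrec g) :
    Primrec (fun a => (f a).testBit (g a)) := by
  have h : Primrec fun a => f a / 2 ^ g a % 2 == 1 :=
    Primrec.beq.comp (Primrec.nat_mod.comp (Primrec.nat_div.comp hf
      (primrec_pow (Primrec.const 2) hg)) (Primrec.const 2)) (Primrec.const 1)
  refine h.of_eq fun a => ?_
  rw [Nat.testBit_eq_decide_div_mod_eq, beq_eq_decide]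

@[fun_prop] theorem primrec_toNat {f : α → Bool} (hf : Primrec f) :
    Primrec (fun a => (f a).toNat) := (Primrec.dom_bool Bool.toNat).comp hf

@[fun_prop] theorem primrec_not {f : α → Bool} (hf : Primrec f) :
    Primrec (fun a => !f a) := Primrec.not.comp hf

@[fun_prop] theorem primrec_and {f g : α → Bool} (hf : Primrec f) (hg : Primrec g) :
    Primrec (fun a => f a && g a) := Primrec.and.comp hf hg

@[fun_prop] theorem primrec_or {f g : α → Bool} (hf : Primrec f) (hg : Primrec g) :
    Primrec (fun a => f a || g a) := Primrec.or.comp hf hg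

@[fun_prop] theorem primrec_beq {f g : α → ℕ} (hf : Primrec f) (hg : Primrec g) :
    Primrec (fun a => f a == g a) := Primrec.beq.comp hf hg

@[fun_prop] theorem primrec_le {f g : α → ℕ} (hf : Primrec f) (hg : Primrec g) :
    Primrec (fun a => decide (f a ≤ g a)) := Primrec.nat_le.decide.comp hf hg

@[fun_prop] theorem primrec_cond {c : α → Bool} {f g : α → σ} (hc : Primrec c) (hf : Primrec f)
    (hg : Primrec g) : Primrec (fun a => bif c a then f a else g a) := Primrec.cond hc hf hg

@[fun_prop] theorem primrec_cons {f : α → σ} {g : α → List σ} (hf : Primrec f) (hg : Primrec g) :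
    Primrec (fun a => f a :: g a) := Primrec.list_cons.comp hf hg

@[fun_prop] theorem primrec_range {f : α → ℕ} (hf : Primrec f) :
    Primrec (fun a => List.range (f a)) := Primrec.list_range.comp hf

@[fun_prop] theorem primrec_map {f : α → List β} {g : α → β → σ} (hf : Primrec f)
    (hg : Primrec (fun p : α × β => g p.1 p.2)) : Primrec (fun a => (f a).map (g a)) :=
  Primrec.list_map hf hg

@[fun_prop] theorem primrec_flatMap {f : α → List β} {g : α → β → List σ} (hf : Primrec f)
    (hg : Primrec (fun p : α × β => g p.1 p.2)) : Primrec (fun a => (f a).flatMap (g a)) :=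
  Primrec.list_flatMap hf hg

@[fun_prop] theorem primrec_contains {f : α → List ℕ} {g : α → ℕ} (hf : Primrec f)
    (hg : Primrec g) : Primrec (fun a => (f a).contains (g a)) := by
  have h := (PrimrecRel.exists_mem_list (R := fun a b : ℕ => a = b) Primrec.eq).comp hf hg
  exact h.decide.of_eq fun a => by simp

@[fun_prop] theorem primrec_natPair {f g : α → ℕ} (hf : Primrec f) (hg : Primrec g) :
    Primrec (fun a => Nat.pair (f a) (g a)) := Primrec₂.natPair.comp hf hg

@[fun_prop] theorem primrec_unpair {f : α → ℕ} (hf : Primrec f) :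
    Primrec (fun a => (f a).unpair) := Primrec.unpair.comp hf

@[fun_prop] theorem primrec_stateCode : Primrec stateCode := by
  unfold stateCode; fun_prop

@[fun_prop] theorem primrec_stateOf : Primrec stateOf := by
  unfold stateOf; fun_prop

@[fun_prop] theorem primrec_mainRules : Primrec fun p : Params × SimState => mainRules p.1 p.2 := by
  unfold mainRules sel; fun_prop

@[fun_prop] theorem primrec_applicable : Primrec fun p : (Params × SimState) × PebbleTransitionCode =>
    applicable p.1.1 p.1.2 p.2 := by
  unfold applicable; fun_prop

@[fun_prop] theorem primrec_targets : Primrec fun p : (Params × SimState) × PebbleTransitionCode =>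
    targets p.1.1 p.1.2 p.2 := by
  unfold targets main move guess; fun_prop

@[fun_prop] theorem primrec_choices : Primrec fun p : Params × SimState => choices p.1 p.2 := by
  unfold choices; fun_prop

@[fun_prop] theorem primrec_selRules : Primrec fun p : Params × SimState => selRules p.1 p.2 := by
  unfold selRules; fun_prop

@[fun_prop] theorem primrec_moveRules : Primrec fun p : Params × SimState => moveRules p.2 := by
  unfold moveRules main; fun_prop

@[fun_prop] theorem primrec_guessRules :
    Primrec fun p : Params × SimState => guessRules p.1 p.2 := by
  unfold guessRules place; fun_prop

@[fun_prop] theorem primrec_placeRules :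
    Primrec fun p : Params × SimState => placeRules p.1 p.2 := by
  unfold placeRules store main; fun_prop

@[fun_prop] theorem primrec_storeRules : Primrec fun p : Params × SimState => storeRules p.2 := by
  unfold storeRules main; fun_prop

theorem primrec_rules : Primrec fun p : Params × SimState => rules p.1 p.2 := by
  unfold rules; fun_prop

theorem primrec_isFinal : Primrec fun p : Params × SimState => isFinal p.1 p.2 := by
  unfold isFinal; fun_prop

@[fun_prop] theorem primrec_bound : Primrec bound := by
  unfold bound stateCode; fun_prop

theorem primrec_simCode : Primrec simCode := by
  have h1 : Primrec fun p : Params × ℕ => rules p.1 (stateOf p.2) :=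
    primrec_comp (f := fun p : Params × SimState => rules p.1 p.2)
      (g := fun p : Params × ℕ => (p.1, stateOf p.2)) primrec_rules (by fun_prop)
  have h2 : Primrec fun p : Params × ℕ => isFinal p.1 (stateOf p.2) :=
    primrec_comp (f := fun p : Params × SimState => isFinal p.1 p.2)
      (g := fun p : Params × ℕ => (p.1, stateOf p.2)) primrec_isFinal (by fun_prop)
  unfold simCode ruleCode main
  refine primrec_bound.pair (Primrec.pair (by fun_prop) (Primrec.pair ?_ ?_))
  · fun_prop
  · fun_prop

end Primrec

/-! ### Acceptance of the simulation in terms of decoded states -/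

theorem simCode_fst (P : Params) : (simCode P).1 = bound P := by
  rw [simCode]

theorem simCode_init (P : Params) :
    (simCode P).2.1 = stateCode (main P.2.1 (P.2.2.2.1 % (P.2.2.1 + 1)) 2 0) := by
  rw [simCode]

theorem mem_simCode_trans {P : Params} {r : RegisterTransitionCode} :
    r ∈ (simCode P).2.2.2 ↔
      ∃ x < (simCode P).1 + 1, ∃ t ∈ rules P (stateOf x), ruleCode x t = r := by
  rw [simCode_fst]
  simp [simCode]

theorem mem_simCode_final {P : Params} {x : ℕ} (hx : x < (simCode P).1 + 1) :
    x ∈ (simCode P).2.2.1 ↔ isFinal P (stateOf x) = true := by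
  rw [simCode_fst] at hx
  simp only [simCode, List.mem_flatMap, List.mem_range]
  constructor
  · rintro ⟨x, -, hx⟩
    cases h : isFinal P (stateOf x) <;> simp_all
  · intro h
    exact ⟨x, hx, by simp [h]⟩

attribute [irreducible] simCode

/-- The rule fires on the input `w` at position `h` with register content `u`, if acceptance of its
targets is given by `X`. -/
def Fires {s : ℕ} {D : Type*} (w : List (Fin s × D)) (X : SimState → ℕ → Option D → Prop) (h : ℕ)
    (u : Option D) : Rule → Prop
  | (0, 0, false, [y]) => tape w h = .leftEnd ∧ X y h u
  | (1, 0, false, [y]) => tape w h = .rightEnd ∧ X y h u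
  | (2, a, b, [y]) => ∃ σ d, tape w h = .letter (σ, d) ∧ σ.val = a ∧ (b = true ↔ u = some d) ∧ X y h u
  | (3, 0, false, [y]) => X y h u
  | (3, 0, true, [y]) => ∃ σ d, tape w h = .letter (σ, d) ∧ X y h (some d)
  | (4, 0, false, y :: ys) => ∀ z ∈ y :: ys, X z h u
  | (5, 0, false, y :: ys) => ∃ z ∈ y :: ys, X z h u
  | (6, 0, false, [y]) => h ≤ w.length ∧ X y (h + 1) u
  | _ => False

theorem map_stateCode_eq {N : ℕ} {l : List SimState} {qs : List (Fin N)}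
    (h : l.map stateCode = qs.map Fin.val) : l = qs.map fun q => stateOf q.val := by
  have := congrArg (List.map stateOf) h
  simpa [List.map_map, Function.comp_def, stateOf_stateCode] using this

/-- The simulating one-register automaton. -/
abbrev simRA (P : Params) (D : Type*) :
    OneRegisterAutomaton (Fin P.1) D (Fin ((simCode P).1 + 1)) :=
  OneRegisterAutomaton.ofCode P.1 D (simCode P)

theorem mem_simRA_trans {P : Params} {D : Type*}
    {r : RegisterTransition (Fin P.1) (Fin ((simCode P).1 + 1))} :
    r ∈ (simRA P D).trans ↔
      ∃ x < (simCode P).1 + 1, ∃ t ∈ rules P (stateOf x), ruleCode x t = r.code :=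
  mem_simCode_trans

theorem mem_simRA_final {P : Params} {D : Type*} {q : Fin ((simCode P).1 + 1)} :
    q ∈ (simRA P D).final ↔ isFinal P (stateOf q.val) = true :=
  mem_simCode_final q.2

theorem rule_of_mem_trans {P : Params} {D : Type*}
    {r : RegisterTransition (Fin P.1) (Fin ((simCode P).1 + 1))} (h : r ∈ (simRA P D).trans)
    {n a : ℕ} {q : Fin ((simCode P).1 + 1)} {b : Bool} {qs : List (Fin ((simCode P).1 + 1))}
    (hr : r.code = (n, q.val, a, b, qs.map Fin.val)) :
    (n, a, b, qs.map fun q => stateOf q.val) ∈ rules P (stateOf q.val) := by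
  obtain ⟨x, -, t, ht, he⟩ := mem_simRA_trans.1 h
  rw [hr] at he
  obtain ⟨t1, t2, t3, t4⟩ := t
  simp only [ruleCode, Prod.mk.injEq] at he
  obtain ⟨rfl, rfl, rfl, rfl, h4⟩ := he
  rwa [← map_stateCode_eq h4]

/-- An induction principle in which the numbering of states no longer appears. Every number decodes
to a state, so no range condition is needed. -/
theorem leadsTo_induction {P : Params} {D : Type*} {w : List (Fin P.1 × D)}
    {X : SimState → ℕ → Option D → Prop}
    (hf : ∀ y h u, isFinal P y = true → X y h u)
    (hr : ∀ y h u, ∀ t ∈ rules P y, Fires w X h u t → X y h u)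
    {c : RegisterConfig D (Fin ((simCode P).1 + 1))} (hc : (simRA P D).LeadsToAcceptance w c) :
    X (stateOf c.state.val) c.head c.register := by
  induction hc with
  | final c hc => exact hf _ _ _ (mem_simRA_final.1 hc)
  | step c c' hs _ ih =>
    cases hs with
    | atLeft j q q' u ht hj =>
      exact hr _ _ _ _ (rule_of_mem_trans ht (qs := [q']) rfl) ⟨hj, ih⟩
    | atRight j q q' u ht hj =>
      exact hr _ _ _ _ (rule_of_mem_trans ht (qs := [q']) rfl) ⟨hj, ih⟩
    | read j q q' u σ d b ht hj hb =>
      exact hr _ _ _ _ (rule_of_mem_trans ht (qs := [q']) rfl) ⟨σ, d, hj, rfl, hb, ih⟩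
    | skip j q q' u ht =>
      exact hr _ _ _ _ (rule_of_mem_trans ht (qs := [q']) rfl) ih
    | store j q q' u σ d ht hj =>
      exact hr _ _ _ _ (rule_of_mem_trans ht (qs := [q']) rfl) ⟨σ, d, hj, ih⟩
    | right j q q' u ht hj =>
      exact hr _ _ _ _ (rule_of_mem_trans ht (qs := [q']) rfl) ⟨hj, ih⟩
  | disj j q q₁ qs u ht p hp _ ih =>
    exact hr _ _ _ _ (rule_of_mem_trans ht (qs := q₁ :: qs) rfl)
      ⟨stateOf p.val, List.mem_map (l := q₁ :: qs) (f := fun q => stateOf q.val) |>.2 ⟨p, hp, rfl⟩, ih⟩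
  | conj j q q₁ qs u ht _ ih =>
    refine hr _ _ _ _ (rule_of_mem_trans ht (qs := q₁ :: qs) rfl) fun z hz => ?_
    obtain ⟨p, hp, rfl⟩ := List.mem_map (l := q₁ :: qs) (f := fun q => stateOf q.val) |>.1 hz
    exact ih p hp

/-! ### Finitely many states suffice -/

/-- All components of the state are in the range needed by the simulation. -/
def InRange (P : Params) (y : SimState) : Prop :=
  y.1 ≤ 7 ∧ y.2.1 ≤ P.2.1 ∧ y.2.2.1 ≤ P.2.2.1 ∧ y.2.2.2.1 ≤ 2 ∧ y.2.2.2.2.1 ≤ 2 ^ (P.2.2.1 + 1) ∧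
    y.2.2.2.2.2.1 ≤ P.1 + 1 ∧ y.2.2.2.2.2.2 ≤ 2 ^ (P.2.2.1 + 1)

theorem pair_le_pair {a b c d : ℕ} (h : a ≤ c) (h' : b ≤ d) : Nat.pair a b ≤ Nat.pair c d := by
  refine le_trans (b := Nat.pair c b) ?_ ?_
  · rcases h.eq_or_lt with rfl | h
    · rfl
    · exact (Nat.pair_lt_pair_left _ h).le
  · rcases h'.eq_or_lt with rfl | h'
    · rfl
    · exact (Nat.pair_lt_pair_right _ h').le

/-- Pairing is monotone in both arguments, so the code of the componentwise largest state bounds all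
others. -/
theorem InRange.stateCode_lt {P : Params} {y : SimState} (h : InRange P y) :
    stateCode y < (simCode P).1 + 1 := by
  obtain ⟨h1, h2, h3, h4, h5, h6, h7⟩ := h
  rw [simCode_fst]
  exact Nat.lt_succ_of_le (pair_le_pair h1 (pair_le_pair h2 (pair_le_pair h3 (pair_le_pair h4
    (pair_le_pair h5 (pair_le_pair h6 h7))))))

/-- Acceptance of the simulating automaton from the state `y`. -/
def Acc {P : Params} {D : Type*} (w : List (Fin P.1 × D)) (y : SimState) (h : ℕ) (u : Option D) :
    Prop :=
  ∃ hy : stateCode y < (simCode P).1 + 1, (simRA P D).LeadsToAcceptance w ⟨h, ⟨stateCode y, hy⟩, u⟩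

theorem acc_of_isFinal {P : Params} {D : Type*} {w : List (Fin P.1 × D)} {y : SimState} {h : ℕ}
    {u : Option D} (hy : InRange P y) (hf : isFinal P y = true) : Acc w y h u :=
  ⟨hy.stateCode_lt, .final _ (mem_simRA_final.2 (by simpa [stateOf_stateCode] using hf))⟩

theorem mem_trans_of_rule {P : Params} {D : Type*} {y : SimState} {t : Rule} (hy : InRange P y)
    (ht : t ∈ rules P y) {r : RegisterTransition (Fin P.1) (Fin ((simCode P).1 + 1))}
    (hr : ruleCode (stateCode y) t = r.code) : r ∈ (simRA P D).trans :=
  mem_simRA_trans.2 ⟨stateCode y, hy.stateCode_lt, t, by rwa [stateOf_stateCode], hr⟩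

theorem exists_map_val {P : Params} {l : List SimState} (h : ∀ z ∈ l, InRange P z) :
    ∃ qs : List (Fin ((simCode P).1 + 1)), l.map stateCode = qs.map Fin.val := by
  induction l with
  | nil => exact ⟨[], rfl⟩
  | cons a l ih =>
    obtain ⟨qs, hqs⟩ := ih fun z hz => h z (List.mem_cons_of_mem _ hz)
    exact ⟨⟨stateCode a, (h a List.mem_cons_self).stateCode_lt⟩ :: qs, by simp [hqs]⟩

/-- A converse to `leadsTo_induction`. Here the range matters: it makes the targets of the rule
states of the automaton. -/
theorem acc_of_fires {P : Params} {D : Type*} {w : List (Fin P.1 × D)} {y : SimState} {h : ℕ}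
    {u : Option D} {t : Rule} (hy : InRange P y) (ht : t ∈ rules P y)
    (hr : ∀ z ∈ t.2.2.2, InRange P z) (hF : Fires w (Acc w) h u t) : Acc w y h u := by
  refine ⟨hy.stateCode_lt, ?_⟩
  unfold Fires at hF
  split at hF
  · obtain ⟨hj, hz, hacc⟩ := hF
    exact .step _ _ (.atLeft _ _ ⟨_, hz⟩ _ 
      (mem_trans_of_rule hy ht (by simp [ruleCode, RegisterTransition.code])) hj) hacc
  · obtain ⟨hj, hz, hacc⟩ := hF
    exact .step _ _ (.atRight _ _ ⟨_, hz⟩ _ 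
      (mem_trans_of_rule hy ht (by simp [ruleCode, RegisterTransition.code])) hj) hacc
  · obtain ⟨σ, d, hj, rfl, hb, hz, hacc⟩ := hF
    exact .step _ _ (.read _ _ ⟨_, hz⟩ _ σ d _ 
      (mem_trans_of_rule hy ht (by simp [ruleCode, RegisterTransition.code])) hj hb) hacc
  · obtain ⟨hz, hacc⟩ := hF
    exact .step _ _ (.skip _ _ ⟨_, hz⟩ _ 
      (mem_trans_of_rule hy ht (by simp [ruleCode, RegisterTransition.code]))) hacc
  · obtain ⟨σ, d, hj, hz, hacc⟩ := hF
    exact .step _ _ (.store _ _ ⟨_, hz⟩ _ σ d 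
      (mem_trans_of_rule hy ht (by simp [ruleCode, RegisterTransition.code])) hj) hacc
  · rename_i z zs
    obtain ⟨qs, hqs⟩ := exists_map_val fun x hx => hr x (List.mem_cons_of_mem _ hx)
    refine .conj _ ⟨stateCode y, hy.stateCode_lt⟩ ⟨stateCode z, (hr z List.mem_cons_self).stateCode_lt⟩ qs _
      (mem_trans_of_rule hy ht (by simp [ruleCode, RegisterTransition.code, hqs])) fun p hp => ?_
    have hp' : p.val ∈ (z :: zs).map stateCode := by
      rw [List.map_cons, hqs]
      exact List.mem_map_of_mem (f := Fin.val) hp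
    obtain ⟨x, hx, hxp⟩ := List.mem_map.1 hp'
    obtain ⟨hz, hacc⟩ := hF x hx
    have hpe : p = ⟨stateCode x, hz⟩ := Fin.ext hxp.symm
    rwa [hpe]
  · rename_i z zs
    obtain ⟨qs, hqs⟩ := exists_map_val fun x hx => hr x (List.mem_cons_of_mem _ hx)
    obtain ⟨x, hx, hz, hacc⟩ := hF
    refine .disj _ ⟨stateCode y, hy.stateCode_lt⟩ ⟨stateCode z, (hr z List.mem_cons_self).stateCode_lt⟩ qs _
      (mem_trans_of_rule hy ht (by simp [ruleCode, RegisterTransition.code, hqs]))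
      ⟨stateCode x, hz⟩ ?_ hacc
    refine (List.mem_map_of_injective Fin.val_injective).1 ?_
    rw [List.map_cons, ← hqs, ← List.map_cons (f := stateCode)]
    exact List.mem_map_of_mem hx
  · obtain ⟨hj, hz, hacc⟩ := hF
    exact .step _ _ (.right _ _ ⟨_, hz⟩ _ 
      (mem_trans_of_rule hy ht (by simp [ruleCode, RegisterTransition.code])) hj) hacc
  · exact hF.elim

/-! ### The meaning of the rules of each kind of state -/

/-- The pebble automaton that is simulated. -/
abbrev pebbleAutomaton (P : Params) : TopViewWeakPA (Fin P.1) (Fin (P.2.2.1 + 1)) P.2.1 :=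
  TopViewWeakPA.ofCode P.1 P.2.1 P.2.2

/-- The value under pebble `i + 1` according to the mode and the content of the register. -/
def pebbleValue {D : Type*} (v : ℕ) (u : Option D) : Option (Marked D) :=
  if v = 0 then some .leftEnd else if v = 1 then some .rightEnd else u.map .letter

theorem exists_mainRules_iff {P : Params} {D : Type*} {w : List (Fin P.1 × D)}
    {X : SimState → ℕ → Option D → Prop} {h : ℕ} {u : Option D} {i q v R : ℕ} :
    (∃ t ∈ mainRules P (main i q v R), Fires w X h u t) ↔
      (tape w h = .leftEnd ∧ X (sel i q v R 0 (v == 0).toNat) h u) ∨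
      (tape w h = .rightEnd ∧ X (sel i q v R 1 (v == 1).toNat) h u) ∨
      (∃ σ d, tape w h = .letter (σ, d) ∧
        ((u = some d ∧ X (sel i q v R (σ.val + 2) (decide (2 ≤ v)).toNat) h u) ∨
          (u ≠ some d ∧ X (sel i q v R (σ.val + 2) 0) h u))) := by
  simp only [mainRules, List.mem_cons, List.mem_flatMap, List.mem_range]
  constructor
  · rintro ⟨t, rfl | rfl | ⟨a, -, rfl | rfl | ht⟩, hF⟩
    · exact Or.inl hF
    · exact Or.inr (Or.inl hF)
    · obtain ⟨σ, d, hw, rfl, hb, hX⟩ := hF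
      exact Or.inr (Or.inr ⟨σ, d, hw, Or.inl ⟨hb.1 rfl, hX⟩⟩)
    · obtain ⟨σ, d, hw, rfl, hb, hX⟩ := hF
      exact Or.inr (Or.inr ⟨σ, d, hw, Or.inr ⟨fun h => Bool.false_ne_true (hb.2 h), hX⟩⟩)
    · cases ht
  · rintro (hF | hF | ⟨σ, d, hw, ⟨hu, hX⟩ | ⟨hu, hX⟩⟩)
    · exact ⟨_, Or.inl rfl, hF⟩
    · exact ⟨_, Or.inr (Or.inl rfl), hF⟩
    · exact ⟨_, Or.inr (Or.inr ⟨σ, σ.2, Or.inl rfl⟩), σ, d, hw, rfl, by simp [hu], hX⟩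
    · exact ⟨_, Or.inr (Or.inr ⟨σ, σ.2, Or.inr (Or.inl rfl)⟩), σ, d, hw, rfl, by simp [hu], hX⟩

theorem pebbleValue_eq_leftEnd {D : Type*} {v : ℕ} {u : Option D} :
    pebbleValue v u = some .leftEnd ↔ v = 0 := by
  unfold pebbleValue
  split_ifs <;> cases u <;> simp_all

theorem pebbleValue_eq_rightEnd {D : Type*} {v : ℕ} {u : Option D} :
    pebbleValue v u = some .rightEnd ↔ v = 1 := by
  unfold pebbleValue
  split_ifs <;> cases u <;> simp_all

theorem pebbleValue_eq_letter {D : Type*} {v : ℕ} {u : Option D} {d : D} :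
    pebbleValue v u = some (.letter d) ↔ 2 ≤ v ∧ u = some d := by
  unfold pebbleValue
  split_ifs with h0 h1
  · simp [h0]
  · simp [h1]
  · have : 2 ≤ v := by omega
    cases u <;> simp [this]

/-- Mode and register together determine the value under pebble `i + 1`, so the cases of the two
markers and of a letter merge into one comparison. -/
theorem exists_rules_main_iff {P : Params} {D : Type*} {w : List (Fin P.1 × D)}
    {X : SimState → ℕ → Option D → Prop} {h : ℕ} {u : Option D} {i q v R : ℕ} :
    (∃ t ∈ rules P (main i q v R), Fires w X h u t) ↔
      ∃ x, (x = 1 ↔ pebbleValue v u = some (valueAt w h)) ∧ x ≤ 1 ∧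
        X (sel i q v R (labelAt w h).code x) h u := by
  -- The two conditions determine `x`, so the quantifier over `x` can be eliminated in each case.
  have toNat_iff : ∀ (p : Bool) (x : ℕ), (x = 1 ↔ p = true) ∧ x ≤ 1 ↔ x = p.toNat := by
    intro p x
    cases p <;> simp <;> omega
  refine exists_mainRules_iff.trans ?_
  simp only [← and_assoc]
  rcases ht : tape w h with _ | ⟨σ, d⟩ | _
  · have hx : ∀ x, _ := toNat_iff (v == 0)
    simp only [beq_iff_eq] at hx
    simp [valueAt, labelAt, ht, Marked.map, Marked.code, pebbleValue_eq_leftEnd, hx]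
  · by_cases hu : u = some d
    · have hx : ∀ x, _ := toNat_iff (decide (2 ≤ v))
      simp only [decide_eq_true_eq] at hx
      simp [valueAt, labelAt, ht, Marked.map, Marked.code, pebbleValue_eq_letter, hx, hu]
    · have hx : ∀ x, _ := toNat_iff false
      simp only [Bool.false_eq_true, Bool.toNat_false, iff_false] at hx
      simp [valueAt, labelAt, ht, Marked.map, Marked.code, pebbleValue_eq_letter, hx, hu]
  · have hx : ∀ x, _ := toNat_iff (v == 1)
    simp only [beq_iff_eq] at hx
    simp [valueAt, labelAt, ht, Marked.map, Marked.code, pebbleValue_eq_rightEnd, hx]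

theorem code_label_injective {s : ℕ} : Function.Injective (Marked.code (s := s)) := by
  intro a b h
  cases a <;> cases b <;> simp_all [Marked.code, Fin.ext_iff]

theorem label_code_le {s : ℕ} (a : Marked (Fin s)) : a.code ≤ s + 1 := by
  cases a <;> simp [Marked.code]

theorem exists_action {n : ℕ} (h : n ≤ 3) : ∃ a : PebbleAction, a.code = n := by
  interval_cases n
  exacts [⟨.stay, rfl⟩, ⟨.right, rfl⟩, ⟨.liftPebble, rfl⟩, ⟨.placePebble, rfl⟩]

/-- Action codes above `3` yield no target, so every transition that contributes a choice has a
genuine action. -/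
theorem action_le_of_mem_targets {P : Params} {y z : SimState} {t : PebbleTransitionCode}
    (h : z ∈ targets P y t) : t.2.2.2.2.2 ≤ 3 := by
  by_contra hn
  have h0 : t.2.2.2.2.2 ≠ 0 := by omega
  have h1 : t.2.2.2.2.2 ≠ 1 := by omega
  have h2 : t.2.2.2.2.2 ≠ 2 := by omega
  have h3 : t.2.2.2.2.2 ≠ 3 := by omega
  simp [targets, beq_eq_false_iff_ne.2 h0, beq_eq_false_iff_ne.2 h1, beq_eq_false_iff_ne.2 h2,
    beq_eq_false_iff_ne.2 h3] at h

theorem exists_mem_head?_iff {D A : Type*} {w : List (A × D)} {h : ℕ} {r : List ℕ} :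
    (∃ p ∈ r.head?, valueAt w p = valueAt w h) ↔
      r.head?.map (valueAt w) = some (valueAt w h) := by
  cases r <;> simp

/-- The tests in `applicable` combine the filter in `ofCode` with the conditions of `Applies`. By
`hr` the mode and the register stand for the value under pebble `i + 1`, so the bit `x` settles the
comparison of pebbles. -/
theorem mem_choices_iff {P : Params} {D : Type*} {w : List (Fin P.1 × D)} {h i v R x : ℕ}
    {q : Fin (P.2.2.1 + 1)} {r : List ℕ} {u : Option D} {z : SimState}
    (hr : r.head?.map (valueAt w) = pebbleValue v u)
    (hx : x = 1 ↔ pebbleValue v u = some (valueAt w h)) (hx' : x ≤ 1) :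
    z ∈ choices P (sel i q.val v R (labelAt w h).code x) ↔
      ∃ t ∈ (pebbleAutomaton P).trans, TopViewWeakPA.Applies w t ⟨i, q, h, r⟩ ∧
        z ∈ targets P (sel i q.val v R (labelAt w h).code x) t.code := by
  rw [← hr, ← exists_mem_head?_iff] at hx
  have hb : ∀ b : Bool, b.toNat = x ↔ (b = true ↔ x = 1) := by
    intro b
    cases b <;> simp <;> omega
  simp only [choices, List.mem_flatMap]
  constructor
  · rintro ⟨⟨t1, t2, t3, t4, t5, t6⟩, ht, hz⟩
    cases ha : applicable P (sel i q.val v R (labelAt w h).code x) (t1, t2, t3, t4, t5, t6)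
    · simp [ha] at hz
    · simp only [ha, cond_true] at hz
      obtain ⟨a, ha'⟩ := exists_action (action_le_of_mem_targets hz)
      simp only [applicable, sel, Bool.and_eq_true, beq_iff_eq, decide_eq_true_eq, Bool.or_eq_true,
        Bool.not_eq_true', hb] at ha
      obtain ⟨⟨⟨⟨⟨⟨⟨rfl, h1⟩, h2⟩, h3⟩, rfl⟩, h4⟩, rfl⟩, h5⟩ := ha
      dsimp only at ha' h1 h2 h3 h4 h5
      have hc : (PebbleTransition.mk t1 (labelAt w h) t3 q ⟨t5, Nat.lt_succ_of_le h5⟩ a).code =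
          (t1, (labelAt w h).code, t3, q.val, t5, t6) := by
        simp [PebbleTransition.code, ha']
      refine ⟨⟨t1, labelAt w h, t3, q, ⟨t5, Nat.lt_succ_of_le h5⟩, a⟩, ⟨?_, ⟨h1, h2⟩, ?_⟩,
        ⟨rfl, rfl, rfl, ?_⟩, ?_⟩
      · rw [hc]; exact ht
      · rintro (rfl : t3 = true)
        exact h3.resolve_left (by simp)
      · exact h4.trans hx
      · rw [hc]; exact hz
  · rintro ⟨t, ⟨ht, ⟨h1, h2⟩, h3⟩, ⟨rfl, rfl, hl, hs⟩, hz⟩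
    refine ⟨t.code, ht, ?_⟩
    have ha : applicable P (sel t.pebble t.source.val v R (labelAt w h).code x) t.code = true := by
      simp only [applicable, sel, Bool.and_eq_true, beq_iff_eq, decide_eq_true_eq, Bool.or_eq_true,
        Bool.not_eq_true', hb, PebbleTransition.code, hl, true_and, and_true]
      refine ⟨⟨⟨⟨h1, h2⟩, ?_⟩, hs.trans hx.symm⟩, Nat.le_of_lt_succ t.target.2⟩
      cases h : t.same
      · simp
      · exact Or.inr (h3 h)
    rw [ha]
    exact hz

theorem exists_rules_sel_iff {P : Params} {D : Type*} {w : List (Fin P.1 × D)}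
    {X : SimState → ℕ → Option D → Prop} {h : ℕ} {u : Option D} {i v R σ x : ℕ}
    {q : Fin (P.2.2.1 + 1)} :
    (∃ t ∈ rules P (sel i q v R σ x), Fires w X h u t) ↔
      (q ∈ (pebbleAutomaton P).univ ∧
        ∀ z ∈ accept :: choices P (sel i q v R σ x), X z h u) ∨
      (q ∉ (pebbleAutomaton P).univ ∧
        ∃ z ∈ reject :: choices P (sel i q v R σ x), X z h u) := by
  have hU : q ∈ (pebbleAutomaton P).univ ↔
      (P.2.2.2.2.2.1.contains q.val && !P.2.2.2.2.1.contains q.val) = true := by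
    simp [TopViewWeakPA.ofCode]
  change (∃ t ∈ selRules P (sel i q v R σ x), Fires w X h u t) ↔ _
  rw [hU]
  simp only [selRules, List.mem_singleton, exists_eq_left]
  change Fires w X h u (bif (P.2.2.2.2.2.1.contains q.val && !P.2.2.2.2.1.contains q.val) then _
    else _) ↔ _
  cases (P.2.2.2.2.2.1.contains q.val && !P.2.2.2.2.1.contains q.val) <;> simp [Fires]

theorem exists_rules_move_iff {P : Params} {D : Type*} {w : List (Fin P.1 × D)}
    {X : SimState → ℕ → Option D → Prop} {h : ℕ} {u : Option D} {i q v R : ℕ} :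
    (∃ t ∈ rules P (move i q v R), Fires w X h u t) ↔
      h ≤ w.length ∧ X (main i q v R) (h + 1) u := by
  change (∃ t ∈ moveRules (move i q v R), Fires w X h u t) ↔ _
  simp [moveRules, Fires, move]

theorem exists_rules_guess_iff {P : Params} {D : Type*} {w : List (Fin P.1 × D)}
    {X : SimState → ℕ → Option D → Prop} {h : ℕ} {u : Option D} {i q v R σ : ℕ} :
    (∃ t ∈ rules P (guess i q v R σ), Fires w X h u t) ↔
      X reject h u ∨ ∃ R' < 2 ^ (P.2.2.1 + 1), X (place i q v R σ R') h u := by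
  change (∃ t ∈ guessRules P (guess i q v R σ), Fires w X h u t) ↔ _
  simp only [guessRules, List.mem_singleton, exists_eq_left, Fires, List.exists_mem_cons_iff,
    List.mem_map, List.mem_range, exists_exists_and_eq_and]
  rfl

theorem exists_rules_place_iff {P : Params} {D : Type*} {w : List (Fin P.1 × D)}
    {X : SimState → ℕ → Option D → Prop} {h : ℕ} {u : Option D} {i q v R σ R' : ℕ} :
    (∃ t ∈ rules P (place i q v R σ R'), Fires w X h u t) ↔
      X (store (i - 1) q (min σ 2) R') h u ∧
        ∀ q' < P.2.2.1 + 1, R'.testBit q' = true → X (main i q' v R) h u := by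
  change (∃ t ∈ placeRules P (place i q v R σ R'), Fires w X h u t) ↔ _
  simp only [placeRules, List.mem_singleton, exists_eq_left, Fires, List.forall_mem_cons,
    List.mem_flatMap, List.mem_range, place]
  refine and_congr_right fun _ => ⟨fun H q' hq hR => H _ ⟨q', hq, by simp [hR]⟩, ?_⟩
  rintro H z ⟨q', hq, hz⟩
  cases hR : R'.testBit q'
  · simp [hR] at hz
  · simp only [hR, cond_true, List.mem_singleton] at hz
    exact hz ▸ H q' hq hR

theorem exists_rules_store_iff {P : Params} {D : Type*} {w : List (Fin P.1 × D)}
    {X : SimState → ℕ → Option D → Prop} {h : ℕ} {u : Option D} {i q v R : ℕ} :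
    (∃ t ∈ rules P (store i q v R), Fires w X h u t) ↔
      (v < 2 ∧ X (main i q v R) h u) ∨
      (2 ≤ v ∧ ∃ σ d, tape w h = .letter (σ, d) ∧ X (main i q v R) h (some d)) := by
  change (∃ t ∈ storeRules (store i q v R), Fires w X h u t) ↔ _
  by_cases hv : 2 ≤ v
  · simp [storeRules, store, Fires, hv, Nat.not_lt.2 hv]
  · simp [storeRules, store, Fires, hv, Nat.lt_of_not_le hv]

theorem isFinal_main {P : Params} {i v R : ℕ} {q : Fin (P.2.2.1 + 1)} :
    isFinal P (main i q v R) = true ↔ q ∈ (pebbleAutomaton P).final := by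
  simp [isFinal, main, TopViewWeakPA.ofCode]

/-- The label alone thus decides whether the head can move right. -/
theorem labelAt_code_eq_one_iff {s : ℕ} {D : Type*} {w : List (Fin s × D)} {h : ℕ} :
    (labelAt w h).code = 1 ↔ w.length < h := by
  cases h with
  | zero => simp [labelAt, tape, Marked.map, Marked.code]
  | succ j =>
    rcases lt_or_ge j w.length with hj | hj
    · simp [labelAt, tape, hj, Marked.map, Marked.code]
    · simp [labelAt, tape, hj, Marked.map, Marked.code]

/-! ### Matching the choices with the steps of the pebble automaton -/

/-- The state `z` of the simulation executes the step of the pebble automaton from a configuration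
with head pebble `i` at `h` and the other pebbles at `r` to the configuration `c'`. -/
inductive Executes {m : ℕ} (i v R σ h n : ℕ) (r : List ℕ) : SimState → PebbleConfig (Fin m) → Prop
  | stay (q : Fin m) : Executes i v R σ h n r (main i q.val v R) ⟨i, q, h, r⟩
  | right (q : Fin m) (hh : h ≤ n) : Executes i v R σ h n r (move i q.val v R) ⟨i, q, h + 1, r⟩
  | lift (q : Fin m) (p : ℕ) (r' : List ℕ) (hr : r = p :: r') :
      Executes i v R σ h n r (bif R.testBit q.val then accept else reject) ⟨i + 1, q, p, r'⟩
  | place (q : Fin m) (j : ℕ) (hj : i = j + 1) (hj' : 1 ≤ j) :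
      Executes i v R σ h n r (guess i q.val v R σ) ⟨j, q, h, h :: r⟩

section

variable {P : Params} {D : Type*} {w : List (Fin P.1 × D)} {h i v R x : ℕ}
  {q : Fin (P.2.2.1 + 1)} {r : List ℕ} {u : Option D}

/-- Soundness needs this direction at existential states and the converse at universal ones;
completeness needs them the other way round. -/
theorem exists_step_of_mem_choices {z : SimState} (hk : i + r.length = P.2.1)
    (hr : r.head?.map (valueAt w) = pebbleValue v u)
    (hx : x = 1 ↔ pebbleValue v u = some (valueAt w h)) (hx' : x ≤ 1)
    (hz : z ∈ choices P (sel i q.val v R (labelAt w h).code x)) :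
    ∃ c', (pebbleAutomaton P).Step w ⟨i, q, h, r⟩ c' ∧
      Executes i v R (labelAt w h).code h w.length r z c' := by
  obtain ⟨t, ht, happ, hz⟩ := (mem_choices_iff hr hx hx').1 hz
  cases hact : t.action with
  | stay =>
    simp only [targets, PebbleTransition.code, hact, PebbleAction.code, sel] at hz
    obtain rfl : z = main i t.target.val v R := by simpa using hz
    exact ⟨_, .stay t ht i q h r happ hact, .stay _⟩
  | right =>
    simp only [targets, PebbleTransition.code, hact, PebbleAction.code, sel] at hz
    by_cases hl : w.length < h
    · simp [labelAt_code_eq_one_iff.2 hl] at hz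
    · have : (labelAt w h).code ≠ 1 := fun h' => hl (labelAt_code_eq_one_iff.1 h')
      obtain rfl : z = move i t.target.val v R := by
        simpa [beq_eq_false_iff_ne.2 this] using hz
      exact ⟨_, .right t ht i q h r happ hact (not_lt.1 hl), .right _ (not_lt.1 hl)⟩
  | liftPebble =>
    simp only [targets, PebbleTransition.code, hact, PebbleAction.code, sel] at hz
    -- Since `i` and the number of other pebbles add up to the total, a pebble to lift to exists
    -- exactly when `i` is below the total, which the state can test.
    cases r with
    | nil =>
      have : ¬ i + 1 ≤ P.2.1 := by simp at hk; omega
      simp [this] at hz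
    | cons p r =>
      have : i + 1 ≤ P.2.1 := by simp at hk; omega
      obtain rfl : z = bif R.testBit t.target.val then accept else reject := by
        simpa [this] using hz
      exact ⟨_, .lift t ht i q h p r happ hact, .lift _ _ _ rfl⟩
  | placePebble =>
    simp only [targets, PebbleTransition.code, hact, PebbleAction.code, sel] at hz
    by_cases hi : 2 ≤ i
    · obtain ⟨j, rfl⟩ : ∃ j, i = j + 1 := ⟨i - 1, by omega⟩
      obtain rfl : z = guess (j + 1) t.target.val v R (labelAt w h).code := by
        simpa [hi] using hz
      exact ⟨_, .place t ht j q h r happ hact (by omega), .place _ j rfl (by omega)⟩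
    · simp [hi] at hz

theorem exists_mem_choices_of_step {c' : PebbleConfig (Fin (P.2.2.1 + 1))}
    (hk : i + r.length = P.2.1)
    (hr : r.head?.map (valueAt w) = pebbleValue v u)
    (hx : x = 1 ↔ pebbleValue v u = some (valueAt w h)) (hx' : x ≤ 1)
    (hs : (pebbleAutomaton P).Step w ⟨i, q, h, r⟩ c') :
    ∃ z ∈ choices P (sel i q.val v R (labelAt w h).code x),
      Executes i v R (labelAt w h).code h w.length r z c' := by
  cases hs with
  | stay t ht _ _ _ _ happ hact =>
    refine ⟨_, (mem_choices_iff hr hx hx').2 ⟨t, ht, happ, ?_⟩, .stay _⟩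
    simp [targets, PebbleTransition.code, hact, PebbleAction.code, sel]
  | right t ht _ _ _ _ happ hact hh =>
    refine ⟨_, (mem_choices_iff hr hx hx').2 ⟨t, ht, happ, ?_⟩, .right _ hh⟩
    have : (labelAt w h).code ≠ 1 := fun h' => not_lt.2 hh (labelAt_code_eq_one_iff.1 h')
    simp [targets, PebbleTransition.code, hact, PebbleAction.code, sel,
      beq_eq_false_iff_ne.2 this]
  | lift t ht _ _ _ p r happ hact =>
    refine ⟨_, (mem_choices_iff hr hx hx').2 ⟨t, ht, happ, ?_⟩, .lift _ _ _ rfl⟩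
    have : i + 1 ≤ P.2.1 := by simp at hk; omega
    simp [targets, PebbleTransition.code, hact, PebbleAction.code, sel, this]
  | place t ht j _ _ _ happ hact hi =>
    refine ⟨_, (mem_choices_iff hr hx hx').2 ⟨t, ht, happ, ?_⟩, .place _ _ rfl hi⟩
    simp [targets, PebbleTransition.code, hact, PebbleAction.code, sel, hi]

end

/-! ### Soundness -/

/-- The pebble automaton accepts from the configuration `c q' r` for all `q'` with number `q` and all
positions `r` of the pebbles above `i` that are represented by the mode `v`, the register content
`u` and the return set `R`. -/
def AcceptsFrom {P : Params} {D : Type*} (w : List (Fin P.1 × D)) (i q v R : ℕ) (u : Option D)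
    (c : Fin (P.2.2.1 + 1) → List ℕ → PebbleConfig (Fin (P.2.2.1 + 1))) : Prop :=
  ∀ (q' : Fin (P.2.2.1 + 1)) (r : List ℕ), q'.val = q → i + r.length = P.2.1 →
    r.head?.map (valueAt w) = pebbleValue v u →
    (∀ p : Fin (P.2.2.1 + 1), R.testBit p.val = true → ∃ j r', r = j :: r' ∧
      (pebbleAutomaton P).LeadsToAcceptance w ⟨i + 1, p, j, r'⟩) →
    (pebbleAutomaton P).LeadsToAcceptance w (c q' r)

/-- What acceptance of the simulation from a given state says about the pebble automaton. -/
def Sound {P : Params} {D : Type*} (w : List (Fin P.1 × D)) :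
    SimState → ℕ → Option D → Prop
  | (0, i, q, v, R, _, _), h, u => AcceptsFrom w i q v R u fun q' r => ⟨i, q', h, r⟩
  -- An arbitrary state may carry a wrong label or comparison bit, so their correctness is a
  -- premise; here and in kinds `3` and `4` the predecessors supply it.
  | (1, i, q, v, R, σ, x), h, u => σ = (labelAt w h).code →
      (x = 1 ↔ pebbleValue v u = some (valueAt w h)) → x ≤ 1 →
      AcceptsFrom w i q v R u fun q' r => ⟨i, q', h, r⟩
  | (2, i, q, v, R, _, _), h, u =>
      h ≤ w.length ∧ AcceptsFrom w i q v R u fun q' r => ⟨i, q', h + 1, r⟩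
  | (3, i, q, v, R, σ, _), h, u => σ = (labelAt w h).code → 2 ≤ i →
      AcceptsFrom w i q v R u fun q' r => ⟨i - 1, q', h, h :: r⟩
  | (4, i, q, v, R, σ, _), h, u => σ = (labelAt w h).code → 2 ≤ i →
      AcceptsFrom w i q v R u fun q' r => ⟨i - 1, q', h, h :: r⟩
  | (5, i, q, v, R, _, _), h, u =>
      (v < 2 ∧ AcceptsFrom w i q v R u fun q' r => ⟨i, q', h, r⟩) ∨
      (2 ≤ v ∧ ∃ σ d, tape w h = .letter (σ, d) ∧
        AcceptsFrom w i q v R (some d) fun q' r => ⟨i, q', h, r⟩)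
  | (6, _), _, _ => True
  | _, _, _ => False

section

variable {P : Params} {D : Type*} {w : List (Fin P.1 × D)}

/-- At a lift the accepting sink carries no information about the pebble automaton; acceptance comes
from the promise `hR`, which applies because the return set contains the new state. -/
theorem leadsTo_of_executes {h i v R : ℕ} {r : List ℕ} {u : Option D}
    {z : SimState} {c' : PebbleConfig (Fin (P.2.2.1 + 1))}
    (hk : i + r.length = P.2.1) (hr : r.head?.map (valueAt w) = pebbleValue v u)
    (hR : ∀ p : Fin (P.2.2.1 + 1), R.testBit p.val = true → ∃ j r', r = j :: r' ∧
      (pebbleAutomaton P).LeadsToAcceptance w ⟨i + 1, p, j, r'⟩)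
    (he : Executes i v R (labelAt w h).code h w.length r z c') (hz : Sound w z h u) :
    (pebbleAutomaton P).LeadsToAcceptance w c' := by
  cases he with
  | stay q => exact hz q r rfl hk hr hR
  | right q hh => exact hz.2 q r rfl hk hr hR
  | lift q p r' hr' =>
    cases hb : R.testBit q.val with
    | false => rw [hb] at hz; exact hz.elim
    | true =>
      obtain ⟨j, r'', he, hl⟩ := hR q hb
      obtain ⟨rfl, rfl⟩ := List.cons.inj (hr'.symm.trans he)
      exact hl
  | place q j hj hj' =>
    subst hj
    exact hz rfl (by omega) q r rfl hk hr hR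

/-- On an end marker the mode fixes the value whatever the register holds, so `u` is arbitrary. -/
theorem pebbleValue_min_code {h : ℕ} (u : Option D) (hc : (labelAt w h).code < 2) :
    some (valueAt w h) = pebbleValue (min (labelAt w h).code 2) u := by
  rcases ht : tape w h with _ | ⟨σ, d⟩ | _
  · simp [labelAt, valueAt, ht, Marked.map, Marked.code, pebbleValue]
  · simp [labelAt, ht, Marked.map, Marked.code] at hc
  · simp [labelAt, valueAt, ht, Marked.map, Marked.code, pebbleValue]

theorem pebbleValue_min_code_of_letter {h : ℕ} {σ : Fin P.1} {d : D}
    (ht : tape w h = .letter (σ, d)) :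
    some (valueAt w h) = pebbleValue (min (labelAt w h).code 2) (some d) := by
  simp [labelAt, valueAt, ht, Marked.map, Marked.code, pebbleValue]

theorem sound_of_rules {y : SimState} {h : ℕ} {u : Option D}
    (H : ∃ t ∈ rules P y, Fires w (Sound w) h u t) : Sound w y h u := by
  obtain ⟨n, i, q, v, R, σ, x⟩ := y
  match n, H with
  | 0, H =>
    obtain ⟨x, hx, hx', hs⟩ := exists_rules_main_iff.1 H
    exact hs rfl hx hx'
  | 1, H =>
    rintro rfl hx hx' q r rfl hk hr hR
    rcases exists_rules_sel_iff.1 H with ⟨hU, hz⟩ | ⟨hU, z, hz, hs⟩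
    · refine .universal _ hU fun c' hc' => ?_
      obtain ⟨z, hzc, he⟩ := exists_mem_choices_of_step hk hr hx hx' hc'
      exact leadsTo_of_executes hk hr hR he (hz z (List.mem_cons_of_mem _ hzc))
    · rcases List.mem_cons.1 hz with rfl | hz
      · exact hs.elim
      · obtain ⟨c', hc', he⟩ := exists_step_of_mem_choices hk hr hx hx' hz
        have hl := leadsTo_of_executes hk hr hR he hs
        -- The selecting state does not exclude final `q`, but the existential clause does.
        by_cases hF : q ∈ (pebbleAutomaton P).final
        · exact .final _ hF
        · exact .existential _ c' hF hU hc' hl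
  | 2, H => exact exists_rules_move_iff.1 H
  | 3, H =>
    rcases exists_rules_guess_iff.1 H with H | ⟨R', -, H⟩
    · exact H.elim
    · exact H
  | 4, H =>
    rintro rfl hi q r rfl hk hr hR
    obtain ⟨hst, hret⟩ := exists_rules_place_iff.1 H
    -- The resuming branches turn the guessed set `x` into a valid promise for pebble `i - 1`, whose
    -- neighbour above is the present head pebble at `h`.
    have hret' : ∀ p : Fin (P.2.2.1 + 1), x.testBit p.val = true → ∃ j r', h :: r = j :: r' ∧
        (pebbleAutomaton P).LeadsToAcceptance w ⟨i - 1 + 1, p, j, r'⟩ := fun p hp =>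
      ⟨h, r, rfl, by
        rw [Nat.sub_add_cancel (by omega)]
        exact hret p.val p.2 hp p r rfl hk hr hR⟩
    have hk' : i - 1 + (h :: r).length = P.2.1 := by
      simp only [List.length_cons]; omega
    rcases hst with ⟨hv, hst⟩ | ⟨hv, σ, d, ht, hst⟩
    · exact hst q (h :: r) rfl hk' (pebbleValue_min_code u (by omega)) hret'
    · exact hst q (h :: r) rfl hk' (pebbleValue_min_code_of_letter ht) hret'
  | 5, H => exact exists_rules_store_iff.1 H
  | 6, H => trivial
  | n + 7, H =>
    obtain ⟨t, ht, -⟩ := H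
    cases ht

theorem sound_of_isFinal {y : SimState} {h : ℕ} {u : Option D} (hy : isFinal P y = true) :
    Sound w y h u := by
  obtain ⟨n, i, q, v, R, σ, x⟩ := y
  match n, hy with
  | 0, hy =>
    rintro q r rfl - - -
    exact .final _ ((isFinal_main (i := i) (v := v) (R := R)).1 hy)
  | 6, hy => trivial

theorem leadsTo_of_acc {i v R h : ℕ} {q : Fin (P.2.2.1 + 1)} {u : Option D} {r : List ℕ}
    (H : Acc w (main i q v R) h u) (hk : i + r.length = P.2.1)
    (hr : r.head?.map (valueAt w) = pebbleValue v u)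
    (hR : ∀ p : Fin (P.2.2.1 + 1), R.testBit p.val = true → ∃ j r', r = j :: r' ∧
      (pebbleAutomaton P).LeadsToAcceptance w ⟨i + 1, p, j, r'⟩) :
    (pebbleAutomaton P).LeadsToAcceptance w ⟨i, q, h, r⟩ := by
  obtain ⟨hy, H⟩ := H
  have := leadsTo_induction (X := Sound w) (fun y h u hf => sound_of_isFinal hf)
    (fun y h u t ht hF => sound_of_rules ⟨t, ht, hF⟩) H
  rw [stateOf_stateCode] at this
  exact this q r rfl hk hr hR

end

/-! ### Completeness -/

section

variable {P : Params} {D : Type*} {w : List (Fin P.1 × D)}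

theorem inRange_accept : InRange P accept := by simp [InRange, accept]

theorem inRange_reject : InRange P reject := by simp [InRange, reject]

theorem inRange_main {i q v R : ℕ} (hi : i ≤ P.2.1) (hq : q ≤ P.2.2.1) (hv : v ≤ 2)
    (hR : R ≤ 2 ^ (P.2.2.1 + 1)) : InRange P (main i q v R) := by
  simp [InRange, main, *]

theorem inRange_of_mem_choices {y z : SimState} (hy : InRange P y) (hz : z ∈ choices P y) :
    InRange P z := by
  obtain ⟨-, hi, hq, hv, hR, hσ, hx⟩ := hy
  obtain ⟨t, -, hz⟩ := List.mem_flatMap.1 hz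
  cases ha : applicable P y t
  · simp [ha] at hz
  · rw [ha, cond_true] at hz
    have hq' : t.2.2.2.2.1 ≤ P.2.2.1 := by
      simp only [applicable, Bool.and_eq_true, decide_eq_true_eq] at ha
      exact ha.2
    have key : z ∈ [main y.2.1 t.2.2.2.2.1 y.2.2.2.1 y.2.2.2.2.1,
        move y.2.1 t.2.2.2.2.1 y.2.2.2.1 y.2.2.2.2.1, accept, reject,
        guess y.2.1 t.2.2.2.2.1 y.2.2.2.1 y.2.2.2.2.1 y.2.2.2.2.2.1] := by
      unfold targets at hz
      -- Only the shape of the nested conditionals matters, so tests and target states become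
      -- variables.
      generalize (t.2.2.2.2.2 == 0) = b0 at hz
      generalize (t.2.2.2.2.2 == 1) = b1 at hz
      generalize (t.2.2.2.2.2 == 2) = b2 at hz
      generalize (t.2.2.2.2.2 == 3) = b3 at hz
      generalize (y.2.2.2.2.2.1 == 1) = b4 at hz
      generalize decide (y.2.1 + 1 ≤ P.2.1) = b5 at hz
      generalize decide (2 ≤ y.2.1) = b6 at hz
      generalize (y.2.2.2.2.1.testBit t.2.2.2.2.1) = b7 at hz
      generalize main y.2.1 t.2.2.2.2.1 y.2.2.2.1 y.2.2.2.2.1 = z1 at hz ⊢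
      generalize move y.2.1 t.2.2.2.2.1 y.2.2.2.1 y.2.2.2.2.1 = z2 at hz ⊢
      generalize guess y.2.1 t.2.2.2.2.1 y.2.2.2.1 y.2.2.2.2.1 y.2.2.2.2.2.1 = z3 at hz ⊢
      generalize accept = z4 at hz ⊢
      generalize reject = z5 at hz ⊢
      simp only [List.mem_cons, List.not_mem_nil, or_false]
      cases b0
      · cases b1
        · cases b2
          · cases b3
            · cases hz
            · cases b6
              · cases hz
              · exact Or.inr (Or.inr (Or.inr (Or.inr (List.mem_singleton.1 hz))))
          · cases b5
            · cases hz
            · cases b7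
              · exact Or.inr (Or.inr (Or.inr (Or.inl (List.mem_singleton.1 hz))))
              · exact Or.inr (Or.inr (Or.inl (List.mem_singleton.1 hz)))
        · cases b4
          · exact Or.inr (Or.inl (List.mem_singleton.1 hz))
          · cases hz
      · exact Or.inl (List.mem_singleton.1 hz)
    simp only [List.mem_cons, List.not_mem_nil, or_false] at key
    rcases key with rfl | rfl | rfl | rfl | rfl
    · simp [InRange, main, *]
    · simp [InRange, move, *]
    · exact inRange_accept
    · exact inRange_reject
    · simp [InRange, guess, *]

theorem inRange_of_mem_rules {y : SimState} (hy : InRange P y) {t : Rule} (ht : t ∈ rules P y)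
    {z : SimState} (hz : z ∈ t.2.2.2) : InRange P z := by
  have hy' := hy
  obtain ⟨n, i, q, v, R, σ, x⟩ := y
  obtain ⟨-, hi, hq, hv, hR, hσ, hx⟩ := hy
  dsimp only at hi hq hv hR hσ hx
  have hpow : 1 ≤ 2 ^ (P.2.2.1 + 1) := Nat.one_le_two_pow
  have hb : ∀ b : Bool, b.toNat ≤ 2 ^ (P.2.2.1 + 1) := fun b => (Bool.toNat_le b).trans hpow
  match n, ht with
  | 0, ht =>
    replace ht : t ∈ mainRules P (0, i, q, v, R, σ, x) := ht
    simp only [mainRules, List.mem_cons, List.mem_flatMap, List.mem_range, List.not_mem_nil,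
      or_false] at ht
    rcases ht with rfl | rfl | ⟨a, ha, rfl | rfl⟩ <;> obtain rfl := List.mem_singleton.1 hz
    · simp only [InRange, sel]; exact ⟨by omega, hi, hq, hv, hR, by omega, hb _⟩
    · simp only [InRange, sel]; exact ⟨by omega, hi, hq, hv, hR, by omega, hb _⟩
    · simp only [InRange, sel]; exact ⟨by omega, hi, hq, hv, hR, by omega, hb _⟩
    · simp only [InRange, sel]; exact ⟨by omega, hi, hq, hv, hR, by omega, Nat.zero_le _⟩
  | 1, ht =>
    replace ht : t ∈ selRules P (1, i, q, v, R, σ, x) := ht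
    have key : z ∈ accept :: choices P (1, i, q, v, R, σ, x) ∨
        z ∈ reject :: choices P (1, i, q, v, R, σ, x) := by
      obtain rfl := List.mem_singleton.1 ht
      revert hz
      generalize choices P (1, i, q, v, R, σ, x) = l
      dsimp only
      cases (P.2.2.2.2.2.1.contains q && !P.2.2.2.2.1.contains q) with
      | false => exact Or.inr
      | true => exact Or.inl
    rcases key with key | key <;> rcases List.mem_cons.1 key with rfl | key
    · exact inRange_accept
    · exact inRange_of_mem_choices hy' key
    · exact inRange_reject
    · exact inRange_of_mem_choices hy' key
  | 2, ht =>
    replace ht : t ∈ moveRules (2, i, q, v, R, σ, x) := ht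
    obtain rfl := List.mem_singleton.1 ht
    obtain rfl := List.mem_singleton.1 hz
    exact inRange_main hi hq hv hR
  | 3, ht =>
    replace ht : t ∈ guessRules P (3, i, q, v, R, σ, x) := ht
    obtain rfl := List.mem_singleton.1 ht
    rcases List.mem_cons.1 hz with rfl | hz
    · exact inRange_reject
    · obtain ⟨R', hR', rfl⟩ := List.mem_map.1 hz
      simp only [InRange, place]
      exact ⟨by omega, hi, hq, hv, hR, hσ, (List.mem_range.1 hR').le⟩
  | 4, ht =>
    replace ht : t ∈ placeRules P (4, i, q, v, R, σ, x) := ht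
    obtain rfl := List.mem_singleton.1 ht
    rcases List.mem_cons.1 hz with rfl | hz
    · simp only [InRange, store]
      exact ⟨by omega, (Nat.sub_le _ _).trans hi, hq, min_le_right _ _, hx, by omega, by omega⟩
    · obtain ⟨q', hq', hz⟩ := List.mem_flatMap.1 hz
      dsimp only at hz
      cases hx : x.testBit q'
      · simp [hx] at hz
      · simp only [hx, cond_true, List.mem_singleton] at hz
        exact hz ▸ inRange_main hi (Nat.le_of_lt_succ (List.mem_range.1 hq')) hv hR
  | 5, ht =>
    replace ht : t ∈ storeRules (5, i, q, v, R, σ, x) := ht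
    obtain rfl := List.mem_singleton.1 ht
    obtain rfl := List.mem_singleton.1 hz
    exact inRange_main hi hq hv hR
  | n + 6, ht => cases ht

theorem acc_of_rules {y : SimState} {h : ℕ} {u : Option D} (hy : InRange P y)
    (H : ∃ t ∈ rules P y, Fires w (Acc w) h u t) : Acc w y h u := by
  obtain ⟨t, ht, hF⟩ := H
  exact acc_of_fires hy ht (fun z hz => inRange_of_mem_rules hy ht hz) hF

theorem acc_accept {h : ℕ} {u : Option D} : Acc w accept h u :=
  acc_of_isFinal inRange_accept rfl

open Classical in
/-- The number whose bits are the elements of `S`. -/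
noncomputable def bits {n : ℕ} (S : Set (Fin n)) : ℕ := Nat.ofBits fun q : Fin n => decide (q ∈ S)

theorem bits_lt {n : ℕ} (S : Set (Fin n)) : bits S < 2 ^ n := Nat.ofBits_lt_two_pow _

theorem testBit_bits {n : ℕ} (S : Set (Fin n)) (q : Fin n) :
    (bits S).testBit q.val = true ↔ q ∈ S := by
  simp [bits, Nat.testBit_ofBits_lt]

/-- The register mode if the other pebbles are at the positions `r`. -/
def mode (w : List (Fin P.1 × D)) : List ℕ → ℕ
  | [] => 2
  | p :: _ => min (labelAt w p).code 2

theorem mode_le (r : List ℕ) : mode w r ≤ 2 := by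
  cases r <;> simp [mode]

/-- The canonical return set of pebble `i` with the other pebbles at `r`: the states from which the
simulation of pebble `i + 1` accepts. -/
noncomputable def returnSet (w : List (Fin P.1 × D)) : ℕ → List ℕ → ℕ
  | _, [] => 0
  | i, p :: r => bits {q : Fin (P.2.2.1 + 1) | ∀ u, r.head?.map (valueAt w) =
      pebbleValue (mode w r) u → Acc w (main (i + 1) q.val (mode w r) (returnSet w (i + 1) r)) p u}

theorem returnSet_lt (i : ℕ) (r : List ℕ) : returnSet w i r < 2 ^ (P.2.2.1 + 1) := by
  cases r with
  | nil => simp [returnSet]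
  | cons p r => exact bits_lt _

/-- The simulation with the canonical return sets accepts from the given configuration. -/
def Complete (w : List (Fin P.1 × D)) (c : PebbleConfig (Fin (P.2.2.1 + 1))) : Prop :=
  c.pebble + c.others.length = P.2.1 → ∀ u, c.others.head?.map (valueAt w) =
    pebbleValue (mode w c.others) u →
      Acc w (main c.pebble c.state.val (mode w c.others) (returnSet w c.pebble c.others)) c.head u

/-- Up to the pebble count, the right side is `Complete` for the configuration reached by lifting
pebble `i`. It ranges over all register contents that fit the mode, because on an end marker the
content is arbitrary. -/
theorem testBit_returnSet {i p : ℕ} {r : List ℕ} (q : Fin (P.2.2.1 + 1)) :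
    (returnSet w i (p :: r)).testBit q.val = true ↔ ∀ u, r.head?.map (valueAt w) =
      pebbleValue (mode w r) u →
        Acc w (main (i + 1) q.val (mode w r) (returnSet w (i + 1) r)) p u := by
  rw [returnSet, testBit_bits, Set.mem_ofPred_eq]

theorem acc_of_executes {h i : ℕ} {r : List ℕ} {u : Option D} {z : SimState}
    {c' : PebbleConfig (Fin (P.2.2.1 + 1))} (hk : i + r.length = P.2.1)
    (hr : r.head?.map (valueAt w) = pebbleValue (mode w r) u)
    (he : Executes i (mode w r) (returnSet w i r) (labelAt w h).code h w.length r z c')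
    (hc : Complete w c') : Acc w z h u := by
  have hi : i ≤ P.2.1 := by omega
  have hR := (returnSet_lt (w := w) i r).le
  have hv := mode_le (w := w) r
  have hσ := label_code_le (labelAt w h)
  have hpow : 1 ≤ 2 ^ (P.2.2.1 + 1) := Nat.one_le_two_pow
  cases he with
  | stay q => exact hc hk u hr
  | right q hh =>
    refine acc_of_rules ?_ (exists_rules_move_iff.2 ⟨hh, hc hk u hr⟩)
    simp only [InRange, move]
    exact ⟨by omega, hi, Nat.le_of_lt_succ q.2, hv, hR, by omega, by omega⟩
  | lift q p r' hr' =>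
    subst hr'
    have : (returnSet w i (p :: r')).testBit q.val = true :=
      (testBit_returnSet q).2 (hc (by simpa [add_assoc, add_comm 1] using hk))
    rw [this]
    exact acc_accept
  | place q j hj hj' =>
    subst hj
    have hq := Nat.le_of_lt_succ q.2
    have hk' : j + (h :: r).length = P.2.1 := by simp only [List.length_cons]; omega
    have hR' := returnSet_lt (w := w) j (h :: r)
    -- The guess is the canonical return set of the new pebble. Its elements are by definition
    -- states from which resuming with the old register `u` accepts.
    refine acc_of_rules ?_ (exists_rules_guess_iff.2 (Or.inr ⟨returnSet w j (h :: r), hR', ?_⟩))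
    · simp only [InRange, guess]
      exact ⟨by omega, hi, hq, hv, hR, hσ, by omega⟩
    refine acc_of_rules ?_ (exists_rules_place_iff.2 ⟨?_, fun q' hq' hb =>
      (testBit_returnSet ⟨q', hq'⟩).1 hb u hr⟩)
    · simp only [InRange, place]
      exact ⟨by omega, hi, hq, hv, hR, hσ, hR'.le⟩
    refine acc_of_rules ?_ (exists_rules_store_iff.2 ?_)
    · simp only [InRange, store]
      exact ⟨by omega, (Nat.sub_le _ _).trans hi, hq, min_le_right _ _, hR'.le, by omega, by omega⟩
    · rw [Nat.add_sub_cancel]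
      by_cases hσ2 : (labelAt w h).code < 2
      · exact Or.inl ⟨by omega, hc hk' u (pebbleValue_min_code u hσ2)⟩
      · refine Or.inr ⟨by omega, ?_⟩
        rcases ht : tape w h with _ | ⟨σ, d⟩ | _
        · simp [labelAt, ht, Marked.map, Marked.code] at hσ2
        · exact ⟨σ, d, rfl, hc hk' (some d) (pebbleValue_min_code_of_letter ht)⟩
        · simp [labelAt, ht, Marked.map, Marked.code] at hσ2

/-- The comparison bit always exists, so the universal and existential cases only have to treat the
choice of a transition. -/
theorem complete_of_sel {h i : ℕ} {r : List ℕ} {q : Fin (P.2.2.1 + 1)}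
    (H : ∀ u x, i + r.length = P.2.1 → r.head?.map (valueAt w) = pebbleValue (mode w r) u →
      (x = 1 ↔ pebbleValue (mode w r) u = some (valueAt w h)) → x ≤ 1 →
      ∃ t ∈ rules P (sel i q (mode w r) (returnSet w i r) (labelAt w h).code x),
        Fires w (Acc w) h u t) : Complete w ⟨i, q, h, r⟩ := by
  intro hk u hr
  dsimp only at hk hr ⊢
  have hi : i ≤ P.2.1 := by omega
  have hq := Nat.le_of_lt_succ q.2
  have hR := (returnSet_lt (w := w) i r).le
  have hv := mode_le (w := w) r
  have hpow : 1 ≤ 2 ^ (P.2.2.1 + 1) := Nat.one_le_two_pow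
  obtain ⟨x, hx, hx'⟩ : ∃ x, (x = 1 ↔ pebbleValue (mode w r) u = some (valueAt w h)) ∧ x ≤ 1 := by
    by_cases hp : pebbleValue (mode w r) u = some (valueAt w h)
    · exact ⟨1, by simp [hp], le_rfl⟩
    · exact ⟨0, by simp [hp], zero_le_one⟩
  refine acc_of_rules (inRange_main hi hq hv hR) (exists_rules_main_iff.2 ⟨x, hx, hx',
    acc_of_rules ?_ (H u x hk hr hx hx')⟩)
  simp only [InRange, sel]
  exact ⟨by omega, hi, hq, hv, hR, label_code_le _, by omega⟩

theorem complete_of_leadsTo {c : PebbleConfig (Fin (P.2.2.1 + 1))}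
    (H : (pebbleAutomaton P).LeadsToAcceptance w c) : Complete w c := by
  induction H with
  | final c hc =>
    intro hk u _
    exact acc_of_isFinal (inRange_main (by omega) (Nat.le_of_lt_succ c.state.2) (mode_le _)
      (returnSet_lt _ _).le) (isFinal_main.2 hc)
  | universal c hc _ ih =>
    refine complete_of_sel fun u x hk hr hx hx' => exists_rules_sel_iff.2 (Or.inl ⟨hc, ?_⟩)
    intro z hz
    rcases List.mem_cons.1 hz with rfl | hz
    · exact acc_accept
    · obtain ⟨c', hc', he⟩ := exists_step_of_mem_choices hk hr hx hx' hz
      exact acc_of_executes hk hr he (ih c' hc')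
  | existential c c' _ hu hs _ ih =>
    refine complete_of_sel fun u x hk hr hx hx' => exists_rules_sel_iff.2 (Or.inr ⟨hu, ?_⟩)
    obtain ⟨z, hz, he⟩ := exists_mem_choices_of_step hk hr hx hx' hs
    exact ⟨z, List.mem_cons_of_mem _ hz, acc_of_executes hk hr he ih⟩

end

theorem simRA_language (P : Params) (D : Type*) :
    (simRA P D).language = (pebbleAutomaton P).language D := by
  have hmod : P.2.2.2.1 % (P.2.2.1 + 1) < P.2.2.1 + 1 := Nat.mod_lt _ (Nat.succ_pos _)
  have hin : InRange P (main P.2.1 (P.2.2.2.1 % (P.2.2.1 + 1)) 2 0) :=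
    inRange_main le_rfl (Nat.le_of_lt_succ hmod) le_rfl (Nat.zero_le _)
  ext w
  have hacc : w ∈ (simRA P D).language ↔
      Acc w (main P.2.1 (P.2.2.2.1 % (P.2.2.1 + 1)) 2 0) 0 none := by
    have hinit : (simRA P D).init = ⟨_, hin.stateCode_lt⟩ := by
      refine Fin.ext ?_
      change (simCode P).2.1 % ((simCode P).1 + 1) = _
      rw [simCode_init, Nat.mod_eq_of_lt hin.stateCode_lt]
    change (simRA P D).LeadsToAcceptance w ⟨0, (simRA P D).init, none⟩ ↔ _
    rw [hinit]
    exact ⟨fun h => ⟨_, h⟩, fun h => h.2⟩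
  rw [hacc]
  constructor
  · intro h
    -- Mode `2` with an empty register fits the absence of pebbles above `k`, and the return set `0`
    -- has no elements, so the promise is vacuous.
    exact leadsTo_of_acc (q := ⟨_, hmod⟩) (r := []) h (Nat.add_zero _) rfl (by simp)
  · intro h
    have := complete_of_leadsTo (P := P) h (Nat.add_zero _) none rfl
    exact this

end PebbleSim

/-! ## Renaming letters and states -/

section Rename

variable {A B D Q Q' : Type*}

/-- Rename the letters of a data word. -/
def renameWord (e : A → B) (w : List (A × D)) : List (B × D) := w.map (Prod.map e id)

theorem renameWord_symm (e : A ≃ B) (w : List (A × D)) :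
    renameWord e.symm (renameWord e w) = w := by
  simp [renameWord, Function.comp_def, Prod.map]

theorem length_renameWord (e : A → B) (w : List (A × D)) :
    (renameWord e w).length = w.length := List.length_map _

theorem tape_renameWord (e : A → B) (w : List (A × D)) (j : ℕ) :
    tape (renameWord e w) j = (tape w j).map (Prod.map e id) := by
  cases j with
  | zero => rfl
  | succ j =>
    simp only [tape, renameWord, List.getElem?_map]
    cases w[j]? <;> rfl

theorem labelAt_renameWord (e : A → B) (w : List (A × D)) (j : ℕ) :
    labelAt (renameWord e w) j = (labelAt w j).map e := by
  rw [labelAt, labelAt, tape_renameWord]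
  cases tape w j <;> rfl

theorem valueAt_renameWord (e : A → B) (w : List (A × D)) (j : ℕ) :
    valueAt (renameWord e w) j = valueAt w j := by
  rw [valueAt, valueAt, tape_renameWord]
  cases tape w j <;> rfl

/-- Rename the letter and the states of a transition of a pebble automaton. -/
def PebbleTransition.rename (e : A → B) (g : Q → Q') (t : PebbleTransition A Q) :
    PebbleTransition B Q' :=
  ⟨t.pebble, t.label.map e, t.same, g t.source, g t.target, t.action⟩

/-- Rename the state of a configuration of a pebble automaton. -/
def PebbleConfig.rename (g : Q → Q') (c : PebbleConfig Q) : PebbleConfig Q' :=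
  ⟨c.pebble, g c.state, c.head, c.others⟩

theorem PebbleTransition.rename_symm (e : A ≃ B) (g : Q ≃ Q') (t : PebbleTransition A Q) :
    (t.rename e g).rename e.symm g.symm = t := by
  obtain ⟨p, l, s, q, q', a⟩ := t
  cases l <;> simp [PebbleTransition.rename, Marked.map]

namespace TopViewWeakPA

variable {k : ℕ}

theorem Applies.rename (e : A → B) (g : Q → Q') {w : List (A × D)} {t : PebbleTransition A Q}
    {c : PebbleConfig Q} (h : Applies w t c) :
    Applies (renameWord e w) (t.rename e g) (c.rename g) := by
  obtain ⟨h1, h2, h3, h4⟩ := h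
  refine ⟨h1, congrArg g h2, ?_, ?_⟩
  · exact (congrArg (Marked.map e) h3).trans (labelAt_renameWord e w c.head).symm
  · simpa only [PebbleTransition.rename, PebbleConfig.rename, valueAt_renameWord] using h4

theorem Step.rename {M : TopViewWeakPA A Q k} {N : TopViewWeakPA B Q' k} {e : A → B} {g : Q → Q'}
    (hT : ∀ t ∈ M.trans, t.rename e g ∈ N.trans) {w : List (A × D)} {c c' : PebbleConfig Q}
    (h : Step M w c c') : Step N (renameWord e w) (c.rename g) (c'.rename g) := by
  cases h with
  | stay t ht i q h r happ hact => exact .stay _ (hT t ht) i _ h r (happ.rename e g) hact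
  | right t ht i q h r happ hact hh =>
    exact .right _ (hT t ht) i _ h r (happ.rename e g) hact ((length_renameWord e w).symm ▸ hh)
  | lift t ht i q h p r happ hact => exact .lift _ (hT t ht) i _ h p r (happ.rename e g) hact
  | place t ht i q h r happ hact hi =>
    exact .place _ (hT t ht) i _ h r (happ.rename e g) hact hi

/-- A universal state quantifies over all successors, so the transitions have to correspond in both
directions. -/
theorem LeadsToAcceptance.rename {M : TopViewWeakPA A Q k} {N : TopViewWeakPA B Q' k} (e : A ≃ B)
    (g : Q ≃ Q') (hF : ∀ q, q ∈ M.final ↔ g q ∈ N.final) (hU : ∀ q, q ∈ M.univ ↔ g q ∈ N.univ)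
    (hT : ∀ t ∈ M.trans, t.rename e g ∈ N.trans)
    (hT' : ∀ t ∈ N.trans, t.rename e.symm g.symm ∈ M.trans) {w : List (A × D)}
    {c : PebbleConfig Q} (h : LeadsToAcceptance M w c) :
    LeadsToAcceptance N (renameWord e w) (c.rename g) := by
  induction h with
  | final c hc => exact .final _ ((hF _).1 hc)
  | universal c hc _ ih =>
    refine .universal _ ((hU _).1 hc) fun c' hc' => ?_
    have hs := hc'.rename hT'
    rw [renameWord_symm] at hs
    have := ih (c'.rename g.symm) (by simpa [PebbleConfig.rename] using hs)
    simpa [PebbleConfig.rename] using this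
  | existential c c' hf hu hs _ ih =>
    exact .existential _ _ (fun h => hf ((hF _).2 h)) (fun h => hu ((hU _).2 h)) (hs.rename hT) ih

theorem renameWord_mem_language_iff {M : TopViewWeakPA A Q k} {N : TopViewWeakPA B Q' k} (e : A ≃ B)
    (g : Q ≃ Q') (hI : g M.init = N.init) (hF : ∀ q, q ∈ M.final ↔ g q ∈ N.final)
    (hU : ∀ q, q ∈ M.univ ↔ g q ∈ N.univ) (hT : ∀ t, t ∈ M.trans ↔ t.rename e g ∈ N.trans)
    (w : List (A × D)) : renameWord e w ∈ N.language D ↔ w ∈ M.language D := by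
  have hT' : ∀ t ∈ N.trans, t.rename e.symm g.symm ∈ M.trans := fun t ht =>
    (hT _).2 (by simpa using (t.rename_symm e.symm g.symm).symm ▸ ht)
  constructor
  · intro h
    have := LeadsToAcceptance.rename e.symm g.symm (fun q => by simp [hF]) (fun q => by simp [hU])
      hT' (fun t ht => (hT t).1 ht) h
    rw [renameWord_symm] at this
    simpa [PebbleConfig.rename, ← hI, TopViewWeakPA.language] using this
  · intro h
    have := LeadsToAcceptance.rename e g hF hU (fun t => (hT t).1) hT' h
    simpa [PebbleConfig.rename, hI, TopViewWeakPA.language] using this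

end TopViewWeakPA

/-- Rename the letters in a transition of a one-register automaton. -/
def RegisterTransition.rename (e : A → B) : RegisterTransition A Q → RegisterTransition B Q
  | .atLeft q q' => .atLeft q q'
  | .atRight q q' => .atRight q q'
  | .read q σ b q' => .read q (e σ) b q'
  | .store q b q' => .store q b q'
  | .conj q q₁ qs => .conj q q₁ qs
  | .disj q q₁ qs => .disj q q₁ qs
  | .right q q' => .right q q'

theorem RegisterTransition.rename_symm (e : A ≃ B) (t : RegisterTransition A Q) :
    (t.rename e).rename e.symm = t := by
  cases t <;> simp [RegisterTransition.rename]

namespace OneRegisterAutomaton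

/-- Acceptance is monotone in the transitions, as conjunctions are explicit lists of targets; an
inclusion is enough. -/
theorem LeadsToAcceptance.rename {M : OneRegisterAutomaton A D Q} {N : OneRegisterAutomaton B D Q}
    {e : A → B} (hF : M.final ⊆ N.final) (hT : ∀ t ∈ M.trans, t.rename e ∈ N.trans)
    {w : List (A × D)} {c : RegisterConfig D Q} (h : LeadsToAcceptance M w c) :
    LeadsToAcceptance N (renameWord e w) c := by
  induction h with
  | final c hc => exact .final _ (hF hc)
  | step c c' hs _ ih =>
    refine .step _ _ ?_ ih
    cases hs with
    | atLeft j q q' u ht hj => exact .atLeft _ _ _ _ (hT _ ht) (by rw [tape_renameWord, hj]; rfl)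
    | atRight j q q' u ht hj => exact .atRight _ _ _ _ (hT _ ht) (by rw [tape_renameWord, hj]; rfl)
    | read j q q' u σ d b ht hj hb =>
      exact .read _ _ _ _ (e σ) d b (hT _ ht) (by rw [tape_renameWord, hj]; rfl) hb
    | skip j q q' u ht => exact .skip _ _ _ _ (hT _ ht)
    | store j q q' u σ d ht hj =>
      exact .store _ _ _ _ (e σ) d (hT _ ht) (by rw [tape_renameWord, hj]; rfl)
    | right j q q' u ht hj =>
      exact .right _ _ _ _ (hT _ ht) ((length_renameWord e w).symm ▸ hj)
  | disj j q q₁ qs u ht p hp _ ih => exact .disj _ _ _ _ _ (hT _ ht) p hp ih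
  | conj j q q₁ qs u ht _ ih => exact .conj _ _ _ _ _ (hT _ ht) ih

/-- The one-register automaton over `A` that reads each letter `a` as `e a`. -/
def comap (e : A ≃ B) (N : OneRegisterAutomaton B D Q) : OneRegisterAutomaton A D Q where
  init := N.init
  initRegister := N.initRegister
  final := N.final
  trans := {t | t.rename e ∈ N.trans}
  trans_finite := N.trans_finite.preimage
    (Function.LeftInverse.injective (RegisterTransition.rename_symm e)).injOn

theorem mem_language_comap_iff (e : A ≃ B) (N : OneRegisterAutomaton B D Q) (w : List (A × D)) :
    w ∈ (N.comap e).language ↔ renameWord e w ∈ N.language := by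
  constructor
  · intro h
    exact LeadsToAcceptance.rename (N := N) (e := e) subset_rfl (fun t ht => ht) h
  · intro h
    have := LeadsToAcceptance.rename (M := N) (N := N.comap e) (e := e.symm) subset_rfl
      (fun t ht => show (t.rename e.symm).rename e ∈ N.trans by
        simpa using (t.rename_symm e.symm).symm ▸ ht) h
    rwa [renameWord_symm] at this

end OneRegisterAutomaton

end Rename

/-! ### Describing an arbitrary automaton with finite alphabet and state set -/

namespace PebbleSim

theorem action_code_injective : Function.Injective PebbleAction.code := by
  intro a b h
  cases a <;> cases b <;> first | rfl | cases h

theorem transition_code_injective {s m : ℕ} :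
    Function.Injective (PebbleTransition.code (s := s) (m := m)) := by
  rintro ⟨p, l, b, q, q', a⟩ ⟨p', l', b', r, r', a'⟩ h
  simp only [PebbleTransition.code, Prod.mk.injEq, code_label_injective.eq_iff,
    action_code_injective.eq_iff, Fin.val_inj] at h
  obtain ⟨rfl, rfl, rfl, rfl, rfl, rfl⟩ := h
  rfl

/-- The pebble number is the only component of a transition with an infinite range; bounding it by
`k` makes the set of codes finite, so that it can be listed. -/
theorem finite_transition_codes {s m k : ℕ} (T : Set (PebbleTransition (Fin s) (Fin m)))
    (hT : ∀ t ∈ T, t.pebble ≤ k) : (PebbleTransition.code '' T).Finite := by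
  refine Set.Finite.subset ((Set.finite_Iic k).prod ((Set.finite_Iic (s + 1)).prod
    ((Set.finite_univ (α := Bool)).prod ((Set.finite_Iio m).prod ((Set.finite_Iio m).prod
      (Set.finite_Iic 3)))))) ?_
  rintro _ ⟨t, ht, rfl⟩
  refine ⟨hT t ht, label_code_le _, trivial, t.source.2, t.target.2, ?_⟩
  change t.action.code ≤ 3
  cases t.action <;> simp [PebbleAction.code]

theorem exists_list_mem_iff {α : Type*} {S : Set α} (hS : S.Finite) :
    ∃ l : List α, ∀ x, x ∈ l ↔ x ∈ S := ⟨hS.toFinset.toList, by simp⟩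

theorem exists_ofCode {A Q : Type*} [Finite A] [Finite Q] {k : ℕ} (M : TopViewWeakPA A Q k) :
    ∃ (s : ℕ) (e : A ≃ Fin s) (c : TopViewWeakPACode), ∀ (D : Type*) (w : List (A × D)),
      renameWord e w ∈ (TopViewWeakPA.ofCode s k c).language D ↔ w ∈ M.language D := by
  have : Nonempty Q := ⟨M.init⟩
  obtain ⟨m, hm⟩ : ∃ m, Nat.card Q = m + 1 := Nat.exists_eq_succ_of_ne_zero Nat.card_pos.ne'
  let g : Q ≃ Fin (m + 1) := Finite.equivFinOfCardEq hm
  let e : A ≃ Fin (Nat.card A) := Finite.equivFin A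
  have hinj : Function.Injective fun q => (g q).val := Fin.val_injective.comp g.injective
  obtain ⟨lF, hF⟩ := exists_list_mem_iff (M.final.toFinite.image fun q => (g q).val)
  obtain ⟨lU, hU⟩ := exists_list_mem_iff (M.univ.toFinite.image fun q => (g q).val)
  obtain ⟨lT, hT⟩ := exists_list_mem_iff (finite_transition_codes (k := k)
    (PebbleTransition.rename e g '' M.trans) (by
      rintro _ ⟨t, ht, rfl⟩; exact (M.pebble_mem t ht).2))
  refine ⟨_, e, (m, (g M.init).val, lF, lU, lT), fun D w => ?_⟩
  have hF' : ∀ q, (g q).val ∈ lF ↔ q ∈ M.final := fun q =>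
    (hF _).trans (hinj.mem_set_image (s := M.final))
  have hU' : ∀ q, (g q).val ∈ lU ↔ q ∈ M.univ := fun q =>
    (hU _).trans (hinj.mem_set_image (s := M.univ))
  have hT' : ∀ t : PebbleTransition A Q, (t.rename e g).code ∈ lT ↔ t ∈ M.trans := fun t =>
    (hT _).trans (transition_code_injective.mem_set_image.trans
      (Function.LeftInverse.injective (PebbleTransition.rename_symm e g)).mem_set_image)
  refine TopViewWeakPA.renameWord_mem_language_iff e g ?_ (fun q => (hF' q).symm) (fun q => ?_)
    (fun t => ?_) w
  · exact Fin.ext (Nat.mod_eq_of_lt (g M.init).2).symm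
  -- Decoding removes final states from the universal ones; this loses nothing because the two sets
  -- are disjoint in `M`.
  · change _ ↔ (g q).val ∈ lU ∧ (g q).val ∉ lF
    rw [hU', hF']
    exact ⟨fun h => ⟨h, Set.disjoint_left.1 M.univ_disjoint_final h⟩, And.left⟩
  · change _ ↔ (t.rename e g).code ∈ lT ∧ (1 ≤ t.pebble ∧ t.pebble ≤ k) ∧ (t.same = true → t.pebble < k)
    rw [hT']
    exact ⟨fun h => ⟨h, M.pebble_mem t h, M.same_lt t h⟩, And.left⟩

end PebbleSim

theorem mainTheorem2 :
    (∀ (A : Type*) (D : Type*) (Q : Type*) [Finite A] [Infinite D] [Finite Q] (k : ℕ),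
      1 ≤ k → ∀ M : TopViewWeakPA A Q k,
        ∃ (Q' : Type) (_ : Finite Q') (M' : OneRegisterAutomaton A D Q'),
          M'.language = M.language D) ∧
    ∃ f : ℕ × ℕ × TopViewWeakPACode → OneRegisterAutomatonCode, Computable f ∧
      ∀ (s k : ℕ) (c : TopViewWeakPACode), 1 ≤ k → ∀ (D : Type*) [Infinite D],
        (OneRegisterAutomaton.ofCode s D (f (s, k, c))).language =
          (TopViewWeakPA.ofCode s k c).language D := by
  refine ⟨fun A D Q _ _ _ k _ M => ?_, PebbleSim.simCode, PebbleSim.primrec_simCode.to_comp,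
    fun s k c _ D _ => PebbleSim.simRA_language (s, k, c) D⟩
  obtain ⟨s, e, c, h⟩ := PebbleSim.exists_ofCode M
  refine ⟨_, inferInstance, (PebbleSim.simRA (s, k, c) D).comap e, Set.ext fun w => ?_⟩
  rw [OneRegisterAutomaton.mem_language_comap_iff, PebbleSim.simRA_language]
  exact h D w
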